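/- Let $\langle \varphi_e^{(1),X} \mid e\in\mathbb{N}\rangle$ be a standard recursive enumeration of the one-place partial functions that are partial recursive relative to the oracle $X\in\mathbb{N}^{\mathbb{N}}$. Let $P_e=\{X\in\mathbb{N}^{\mathbb{N}}\mid \varphi_e^{(1),X}(0)\uparrow\}$, so that $\langle P_e\rangle_{e\in\mathbb{N}}$ enumerates the $\Pi^0_1$ subclasses of $\mathbb{N}^{\mathbb{N}}$, and let $0'$ be the Turing jump of the zero function, where $X'$ is the characteristic function of $\{e\mid X\notin P_e\}$. Regard $2^{\mathbb{N}}=\{0,1\}^{\mathbb{N}}$ as a subset of $\mathbb{N}^{\mathbb{N}}$. For a finite string $\tau$ of $0$s and $1$s let $[\tau]=\{X\in 2^{\mathbb{N}}\mid X \text{ extends } \tau\}$. For $X,Y\in 2^{\mathbb{N}}$ define $X\oplus Y$ by $(X\oplus Y)(2k)=X(k)$ and $(X\oplus Y)(2k+1)=Y(k)$, and for $S,S'\subseteq 2^{\mathbb{N}}$ let $S\times S'=\{X\oplus Y\mid X\in S,\ Y\in S'\}$. Let $S_1\times\cdots\times S_n=(S_1\times\cdots\times S_{n-1})\times S_n$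 for $n\ge 2$; for $n=1$ this is $S_1$, and for $n=0$ it is by convention the class whose only member is the zero sequence. **Theorem.** There are a nonempty perfect $\Pi^0_1$ class $Q\subseteq 2^{\mathbb{N}}$ and a function $e\mapsto m_e$ from $\mathbb{N}$ to $\mathbb{N}$, computable using an oracle for $0'$, such that for all $e,n\in\mathbb{N}$ and all pairwise distinct strings $\tau_1,\ldots,\tau_n$ of $0$s and $1$s with $|\tau_1|=\cdots=|\tau_n|\ge m_e$, the class $$(Q\cap[\tau_1])\times\cdots\times(Q\cap[\tau_n])$$ is either disjoint from $P_e$ or included in $P_e$. -/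

import Mathlib

/-! ## Oracle computation -/

/-- Programs for partial functions from `ℕ` to `ℕ` with an oracle.  The constructors are those of
`Nat.RecursiveIn`, so the programs with oracle `g` compute exactly the partial functions that are
partial recursive relative to `g` (see `OracleCode.exists_code`). -/
inductive OracleCode : Type
  | zero : OracleCode
  | succ : OracleCode
  | left : OracleCode
  | right : OracleCode
  | oracle : OracleCode
  | pair : OracleCode → OracleCode → OracleCode
  | comp : OracleCode → OracleCode → OracleCode
  | prec : OracleCode → OracleCode → OracleCode
  | rfind : OracleCode → OracleCode

namespace OracleCode

/-- The partial function computed by a program with oracle `g`. -/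
def eval (g : ℕ →. ℕ) : OracleCode → (ℕ →. ℕ)
  | zero => fun _ => 0
  | succ => Nat.succ
  | left => fun n => (Nat.unpair n).1
  | right => fun n => (Nat.unpair n).2
  | oracle => g
  | pair cf ch => fun n => Nat.pair <$> eval g cf n <*> eval g ch n
  | comp cf ch => fun n => eval g ch n >>= eval g cf
  | prec cf ch => fun p =>
      let (a, n) := Nat.unpair p
      n.rec (eval g cf a) fun y IH => do
        let i ← IH
        eval g ch (Nat.pair a (Nat.pair y i))
  | rfind cf => fun a => Nat.rfind fun n => (fun m => m = 0) <$> eval g cf (Nat.pair a n)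

/-- A Gödel numbering of the programs. -/
def encode : OracleCode → ℕ
  | zero => 0
  | succ => 1
  | left => 2
  | right => 3
  | oracle => 4
  | pair cf ch => 4 * Nat.pair (encode cf) (encode ch) + 5
  | comp cf ch => 4 * Nat.pair (encode cf) (encode ch) + 6
  | prec cf ch => 4 * Nat.pair (encode cf) (encode ch) + 7
  | rfind cf => 4 * encode cf + 8

/-- The program with a given Gödel number (every natural number is the number of a program). -/
def ofNat : ℕ → OracleCode
  | 0 => zero
  | 1 => succ
  | 2 => left
  | 3 => right
  | 4 => oracle
  | n + 5 =>
    have h0 : n / 4 < n + 5 := by omega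
    have h1 : (n / 4).unpair.1 < n + 5 := lt_of_le_of_lt (Nat.unpair_left_le _) h0
    have h2 : (n / 4).unpair.2 < n + 5 := lt_of_le_of_lt (Nat.unpair_right_le _) h0
    match n % 4 with
    | 0 => pair (ofNat (n / 4).unpair.1) (ofNat (n / 4).unpair.2)
    | 1 => comp (ofNat (n / 4).unpair.1) (ofNat (n / 4).unpair.2)
    | 2 => prec (ofNat (n / 4).unpair.1) (ofNat (n / 4).unpair.2)
    | _ => rfind (ofNat (n / 4))

theorem ofNat_encode (c : OracleCode) : ofNat (encode c) = c := by
  induction c with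
  | zero => simp [encode, ofNat]
  | succ => simp [encode, ofNat]
  | left => simp [encode, ofNat]
  | right => simp [encode, ofNat]
  | oracle => simp [encode, ofNat]
  | pair cf ch hf hh => simp [encode, ofNat, hf, hh]
  | comp cf ch hf hh =>
    have h : (4 * Nat.pair (encode cf) (encode ch) + 1) / 4 = Nat.pair (encode cf) (encode ch) := by
      omega
    simp [encode, ofNat, h, hf, hh]
  | prec cf ch hf hh =>
    have h : (4 * Nat.pair (encode cf) (encode ch) + 2) / 4 = Nat.pair (encode cf) (encode ch) := by
      omega
    simp [encode, ofNat, h, hf, hh]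
  | rfind cf hf =>
    have h : (4 * encode cf + 3) / 4 = encode cf := by omega
    simp [encode, ofNat, h, hf]

/-- The programs with oracle `g` compute exactly the functions partial recursive relative to `g`. -/
theorem exists_code (g f : ℕ →. ℕ) :
    TuringReducible f g ↔ ∃ c : OracleCode, eval g c = f := by
  rw [TuringReducible, RecursiveIn.iff_nat]
  constructor
  · intro h
    induction h with
    | zero => exact ⟨zero, rfl⟩
    | succ => exact ⟨succ, rfl⟩
    | left => exact ⟨left, rfl⟩
    | right => exact ⟨right, rfl⟩
    | oracle k hk => exact ⟨oracle, by rw [Set.mem_singleton_iff.1 hk]; rfl⟩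
    | pair _ _ hf hh =>
      obtain ⟨cf, rfl⟩ := hf
      obtain ⟨ch, rfl⟩ := hh
      exact ⟨pair cf ch, rfl⟩
    | comp _ _ hf hh =>
      obtain ⟨cf, rfl⟩ := hf
      obtain ⟨ch, rfl⟩ := hh
      exact ⟨comp cf ch, rfl⟩
    | prec _ _ hf hh =>
      obtain ⟨cf, rfl⟩ := hf
      obtain ⟨ch, rfl⟩ := hh
      exact ⟨prec cf ch, rfl⟩
    | rfind _ hf =>
      obtain ⟨cf, rfl⟩ := hf
      exact ⟨rfind cf, rfl⟩
  · rintro ⟨c, rfl⟩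
    induction c with
    | zero => exact .zero
    | succ => exact .succ
    | left => exact .left
    | right => exact .right
    | oracle => exact .oracle g rfl
    | pair _ _ hf hh => exact .pair hf hh
    | comp _ _ hf hh => exact .comp hf hh
    | prec _ _ hf hh => exact .prec hf hh
    | rfind _ hf => exact .rfind hf

end OracleCode

/-- `oraclePhi e X` is the `e`-th one-place partial function that is partial recursive relative
to `X`, usually written `φ_e^{(1),X}`. -/
def oraclePhi (e : ℕ) (X : ℕ → ℕ) : ℕ →. ℕ := (OracleCode.ofNat e).eval (X : ℕ →. ℕ)

/-- The enumeration `e ↦ oraclePhi e X` contains all functions partial recursive relative to `X`,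
and no others. -/
theorem exists_index (X : ℕ → ℕ) (f : ℕ →. ℕ) :
    TuringReducible f (X : ℕ →. ℕ) ↔ ∃ e, oraclePhi e X = f := by
  rw [OracleCode.exists_code]
  constructor
  · rintro ⟨c, hc⟩
    exact ⟨c.encode, by rw [oraclePhi, OracleCode.ofNat_encode, hc]⟩
  · rintro ⟨e, he⟩
    exact ⟨OracleCode.ofNat e, he⟩

open Classical in
/-- The Turing jump `X'` of `X`: the characteristic function of the set of all `e` such that
the `e`-th program with oracle `X` converges on input `0`. -/
noncomputable def turingJump (X : ℕ → ℕ) : ℕ → ℕ :=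
  fun e => if (oraclePhi e X 0).Dom then 1 else 0

/-- `0'`, the Turing jump of the zero function. -/
noncomputable def zeroJump : ℕ → ℕ := turingJump fun _ => 0

/-! ## `Π⁰₁` classes -/

/-- The standard enumeration `P_e = {X ∈ ℕ^ℕ | φ_e^{(1),X}(0)↑}` of the `Π⁰₁` subclasses of
Baire space. -/
def piClass (e : ℕ) : Set (ℕ → ℕ) := {X | ¬ (oraclePhi e X 0).Dom}

/-- A subclass of Baire space is `Π⁰₁` if it is one of the `P_e`. -/
def IsPiClass (S : Set (ℕ → ℕ)) : Prop := ∃ e, S = piClass e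

/-- The inclusion of Cantor space `2^ℕ` in Baire space `ℕ^ℕ` (`false ↦ 0`, `true ↦ 1`). -/
def toBaire (X : ℕ → Bool) : ℕ → ℕ := fun k => (X k).toNat

/-! ## Strings, joins and products -/

/-- The basic clopen set of all `X ∈ 2^ℕ` that extend the string `τ`. -/
def stringNhd (τ : List Bool) : Set (ℕ → Bool) :=
  {X | ∀ (k : ℕ) (hk : k < τ.length), X k = τ[k]}

/-- The join `X ⊕ Y`, with `(X ⊕ Y)(2k) = X(k)` and `(X ⊕ Y)(2k+1) = Y(k)`. -/
def seqJoin {A : Type*} (X Y : ℕ → A) : ℕ → A :=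
  fun k => if k % 2 = 0 then X (k / 2) else Y (k / 2)

/-- The product `P × Q = {X ⊕ Y | X ∈ P, Y ∈ Q}`. -/
def classProd {A : Type*} (P Q : Set (ℕ → A)) : Set (ℕ → A) :=
  {Z | ∃ X ∈ P, ∃ Y ∈ Q, Z = seqJoin X Y}

/-- The iterated product `S₁ × ⋯ × Sₙ = (S₁ × ⋯ × Sₙ₋₁) × Sₙ` of subclasses of Cantor space.
The product of one class is the class itself.  By convention the empty product has
the zero sequence as its only member. -/
def classProdN : (n : ℕ) → (Fin n → Set (ℕ → Bool)) → Set (ℕ → Bool)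
  | 0, _ => {fun _ => false}
  | 1, S => S 0
  | n + 2, S => classProd (classProdN (n + 1) fun i => S i.castSucc) (S (Fin.last (n + 1)))

/-! ## Continuity and monotonicity of oracle evaluation -/

/-! The class Q is the set of paths through a perfect binary tree built by a finite injury
construction. Level j of the tree consists of 2^j strings of equal length, the branching nodes, and
every string of level j+1 extends a child of a string of level j. A pair (e, I) with e ≤ j and I a
list of positions in level j poses the question whether the product of the selected cones can be
pushed out of `piClass e`. Leaving `piClass e` is witnessed by a halting computation that reads only
a finite part of the oracle, so all possible witnesses ("candidates") can be enumerated.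

When a candidate for an unsettled pair fits the current tree, level j is replaced by longer strings
chosen from the last level, all later levels are discarded, and (e, I) becomes settled. In every
other case the tree grows by one level. Settled pairs stay forced, because later versions of the
level only extend its strings. Once the levels below j are stable, each change of level j settles a
new pair from a finite set, so level j stabilizes as well (`IsStable.exists_succ`). The limit is a
perfect tree.

The clopen sets covered by the last levels of the stages decrease, and their intersection is Q
(`IsLimit.pathsOf_eq`); hence Q is a Π⁰₁ class although the limit levels themselves are only
computable from 0'.

For a pair settled in the limit the product is disjoint from `piClass e`. For an unsettled pair, a
member of the product outside `piClass e` would yield a candidate on which the construction acts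
after the level has stabilized, which is impossible (`IsLimit.mem_piClass_of_notMem`). Strings
longer than those of level e and meeting Q each isolate one entry of a level above e
(`IsTreeSequence.exists_entry`), so m_e is one more than the string length at level e; 0' finds it
because instability of a stage is r.e. -/

namespace OracleCode

open Filter in
/-- If the oracle `g` is a pointwise limit of the oracles `G i`, then every value computed with
oracle `g` is eventually computed with oracle `G i`. -/
theorem eval_eventually {ι : Type*} {l : Filter ι} {g : ℕ →. ℕ} {G : ι → ℕ →. ℕ}
    (h : ∀ n y, y ∈ g n → ∀ᶠ i in l, y ∈ G i n) (c : OracleCode) :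
    ∀ n y, y ∈ eval g c n → ∀ᶠ i in l, y ∈ eval (G i) c n := by
  induction c with
  | zero => exact fun n y hy => Eventually.of_forall fun _ => hy
  | succ => exact fun n y hy => Eventually.of_forall fun _ => hy
  | left => exact fun n y hy => Eventually.of_forall fun _ => hy
  | right => exact fun n y hy => Eventually.of_forall fun _ => hy
  | oracle => exact h
  | pair cf ch hf hh =>
    intro n y hy
    simp only [eval, Seq.seq, Part.map_eq_map, Part.mem_bind_iff, Part.mem_map_iff] at hy ⊢
    obtain ⟨_, ⟨u, hu, rfl⟩, v, hv, rfl⟩ := hy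
    filter_upwards [hf n u hu, hh n v hv] with i h1 h2
    exact ⟨_, ⟨u, h1, rfl⟩, v, h2, rfl⟩
  | comp cf ch hf hh =>
    intro n y hy
    obtain ⟨u, hu, hy⟩ := Part.mem_bind_iff.1 hy
    filter_upwards [hh n u hu, hf u y hy] with i h1 h2
    exact Part.mem_bind_iff.2 ⟨u, h1, h2⟩
  | prec cf ch hf hh =>
    intro p
    simp only [eval]
    generalize (Nat.unpair p).2 = n
    generalize (Nat.unpair p).1 = a
    induction n with
    | zero => exact fun y hy => hf a y hy
    | succ n ih =>
      intro y hy
      simp only [Part.bind_eq_bind, Part.mem_bind_iff] at hy ⊢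
      obtain ⟨u, hu, hy⟩ := hy
      filter_upwards [ih u hu, hh _ y hy] with i h1 h2
      exact ⟨u, h1, h2⟩
  | rfind cf hf =>
    intro n y hy
    obtain ⟨hy0, hlt⟩ := Nat.mem_rfind.1 hy
    obtain ⟨u, hu, hu0⟩ := (Part.mem_map_iff _).1 hy0
    have hlt' : ∀ m, m < y → ∀ᶠ i in l, ∃ a, a ∈ eval (G i) cf (Nat.pair n m) ∧
        decide (a = 0) = false := by
      intro m hm
      obtain ⟨v, hv, hv0⟩ := (Part.mem_map_iff _).1 (hlt hm)
      filter_upwards [hf _ v hv] with i hi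
      exact ⟨v, hi, hv0⟩
    have hall := (eventually_all_finite (Set.finite_lt_nat y)).2 hlt'
    filter_upwards [hf _ u hu, hall] with i h1 h2
    exact Nat.mem_rfind.2 ⟨(Part.mem_map_iff _).2 ⟨u, h1, hu0⟩,
      fun {m} hm => (Part.mem_map_iff _).2 (h2 m hm)⟩

/-- This is the limit statement for a constant family of oracles along the trivial filter `pure ()`.
-/
theorem eval_mono {g g' : ℕ →. ℕ} (h : ∀ n y, y ∈ g n → y ∈ g' n) (c : OracleCode) (n y : ℕ)
    (hy : y ∈ eval g c n) : y ∈ eval g' c n := by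
  have := eval_eventually (l := pure ()) (G := fun _ : Unit => g') (by simpa using h) c n y hy
  simpa using this

/-! ## Evaluation with a finite string as oracle -/

/-- Replace the oracle calls in a program by calls of the program `o`. -/
def toCode (o : Nat.Partrec.Code) : OracleCode → Nat.Partrec.Code
  | zero => .zero
  | succ => .succ
  | left => .left
  | right => .right
  | oracle => o
  | pair cf ch => .pair (toCode o cf) (toCode o ch)
  | comp cf ch => .comp (toCode o cf) (toCode o ch)
  | prec cf ch => .prec (toCode o cf) (toCode o ch)
  -- `rfind'` starts its search at the second component of its input, so the input is paired with 0.
  | rfind cf => .comp (.rfind' (toCode o cf)) (.pair .id .zero)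

theorem eval_toCode (o : Nat.Partrec.Code) (c : OracleCode) :
    (c.toCode o).eval = c.eval o.eval := by
  induction c with
  | zero => rfl
  | succ => rfl
  | left => rfl
  | right => rfl
  | oracle => rfl
  | pair cf ch hf hh => simp only [toCode, eval, Nat.Partrec.Code.eval, hf, hh]; rfl
  | comp cf ch hf hh => simp only [toCode, eval, Nat.Partrec.Code.eval, hf, hh]; rfl
  | prec cf ch hf hh =>
    funext p
    simp only [toCode, eval, Nat.Partrec.Code.eval, hf, hh, Nat.unpaired]
  | rfind cf hf =>
    funext a
    simp [toCode, eval, Nat.Partrec.Code.eval, hf, Seq.seq, Nat.unpaired, pure, PFun.pure]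
    simp [Part.map_id']

-- Course-of-values recursion on the Gödel number: `l` lists the translations of all smaller
-- programs, so its length is the current number. The defaults of `getD` are never reached, since
-- subprograms have smaller numbers.
open Primrec in
theorem primrec_toCode : Primrec₂ fun (o : Nat.Partrec.Code) (e : ℕ) => (ofNat e).toCode o := by
  let g : Nat.Partrec.Code → List Nat.Partrec.Code → Option Nat.Partrec.Code := fun o l =>
    some <|
      if l.length = 0 then .zero else if l.length = 1 then .succ else if l.length = 2 then .left
      else if l.length = 3 then .right else if l.length = 4 then o
      else if (l.length - 5) % 4 = 0 then
        .pair (l.getD ((l.length - 5) / 4).unpair.1 .zero)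
          (l.getD ((l.length - 5) / 4).unpair.2 .zero)
      else if (l.length - 5) % 4 = 1 then
        .comp (l.getD ((l.length - 5) / 4).unpair.1 .zero)
          (l.getD ((l.length - 5) / 4).unpair.2 .zero)
      else if (l.length - 5) % 4 = 2 then
        .prec (l.getD ((l.length - 5) / 4).unpair.1 .zero)
          (l.getD ((l.length - 5) / 4).unpair.2 .zero)
      else .comp (.rfind' (l.getD ((l.length - 5) / 4) .zero)) (.pair .id .zero)
  have hlen : Primrec fun p : Nat.Partrec.Code × List Nat.Partrec.Code => p.2.length :=
    list_length.comp snd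
  have hsub : Primrec fun p : Nat.Partrec.Code × List Nat.Partrec.Code => p.2.length - 5 :=
    nat_sub.comp hlen (const 5)
  have hdiv : Primrec fun p : Nat.Partrec.Code × List Nat.Partrec.Code => (p.2.length - 5) / 4 :=
    nat_div.comp hsub (const 4)
  have hmod : Primrec fun p : Nat.Partrec.Code × List Nat.Partrec.Code => (p.2.length - 5) % 4 :=
    nat_mod.comp hsub (const 4)
  have hl : Primrec fun p : Nat.Partrec.Code × List Nat.Partrec.Code =>
      p.2.getD ((p.2.length - 5) / 4).unpair.1 .zero :=
    (list_getD _).comp snd (fst.comp (unpair.comp hdiv))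
  have hr : Primrec fun p : Nat.Partrec.Code × List Nat.Partrec.Code =>
      p.2.getD ((p.2.length - 5) / 4).unpair.2 .zero :=
    (list_getD _).comp snd (snd.comp (unpair.comp hdiv))
  have hm : Primrec fun p : Nat.Partrec.Code × List Nat.Partrec.Code =>
      p.2.getD ((p.2.length - 5) / 4) .zero :=
    (list_getD _).comp snd hdiv
  have hg : Primrec₂ g := by
    refine option_some.comp ?_
    refine ite (Primrec.eq.comp hlen (const 0)) (const _) ?_
    refine ite (Primrec.eq.comp hlen (const 1)) (const _) ?_
    refine ite (Primrec.eq.comp hlen (const 2)) (const _) ?_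
    refine ite (Primrec.eq.comp hlen (const 3)) (const _) ?_
    refine ite (Primrec.eq.comp hlen (const 4)) fst ?_
    refine ite (Primrec.eq.comp hmod (const 0)) (Nat.Partrec.Code.primrec₂_pair.comp hl hr) ?_
    refine ite (Primrec.eq.comp hmod (const 1)) (Nat.Partrec.Code.primrec₂_comp.comp hl hr) ?_
    refine ite (Primrec.eq.comp hmod (const 2)) (Nat.Partrec.Code.primrec₂_prec.comp hl hr) ?_
    exact Nat.Partrec.Code.primrec₂_comp.comp (Nat.Partrec.Code.primrec_rfind'.comp hm) (const _)
  refine nat_strong_rec _ hg fun o n => ?_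
  match n with
  | 0 => simp [g, ofNat, toCode]
  | 1 => simp [g, ofNat, toCode]
  | 2 => simp [g, ofNat, toCode]
  | 3 => simp [g, ofNat, toCode]
  | 4 => simp [g, ofNat, toCode]
  | n + 5 =>
    have h0 : n / 4 < n + 5 := by omega
    have h1 : (n / 4).unpair.1 < n + 5 := lt_of_le_of_lt (Nat.unpair_left_le _) h0
    have h2 : (n / 4).unpair.2 < n + 5 := lt_of_le_of_lt (Nat.unpair_right_le _) h0
    have hget : ∀ i, i < n + 5 →
        (List.map (fun e => (ofNat e).toCode o) (List.range (n + 5))).getD i .zero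
          = (ofNat i).toCode o := by
      intro i hi
      simp [List.getD, hi]
    simp only [g, List.length_map, List.length_range, Nat.add_sub_cancel, hget _ h0, hget _ h1,
      hget _ h2]
    have : n % 4 < 4 := Nat.mod_lt _ (by norm_num)
    rw [ofNat]
    rcases (by omega : n % 4 = 0 ∨ n % 4 = 1 ∨ n % 4 = 2 ∨ n % 4 = 3) with h | h | h | h <;>
      simp [h, toCode]

end OracleCode

/-- The finite partial function given by a string. -/
def stringOracle (σ : List ℕ) : ℕ →. ℕ := fun k => (σ[k]? : Part ℕ)

/-- The `e`-th program converges on input `0` when its oracle calls are answered by `σ`. -/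
def HaltsOn (e : ℕ) (σ : List ℕ) : Prop := ((OracleCode.ofNat e).eval (stringOracle σ) 0).Dom

/-- The string is hard-wired by `curry` into a code for list lookup, which replaces the oracle
calls. Halting then becomes the domain of the universal partial recursive function along a
computable map. -/
theorem rePred_haltsOn : REPred fun p : ℕ × List ℕ => HaltsOn p.1 p.2 := by
  have hlook : Partrec fun n : ℕ =>
      (((Encodable.decode (α := List ℕ) n.unpair.1).getD [])[n.unpair.2]? : Part ℕ) := by
    refine Computable.ofOption ?_
    have h1 : Primrec fun n : ℕ => (Encodable.decode (α := List ℕ) n.unpair.1).getD [] :=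
      Primrec.option_getD.comp (Primrec.decode.comp (Primrec.fst.comp Primrec.unpair))
        (Primrec.const [])
    exact (Primrec.list_getElem?.comp h1 (Primrec.snd.comp Primrec.unpair)).to_comp
  obtain ⟨c, hc⟩ := Nat.Partrec.Code.exists_code.1 (Partrec.nat_iff.1 hlook)
  have hstr (σ : List ℕ) : (c.curry (Encodable.encode σ)).eval = stringOracle σ := by
    funext n
    rw [Nat.Partrec.Code.eval_curry, hc]
    simp [stringOracle]
  have hcode : Computable fun p : ℕ × List ℕ =>
      (OracleCode.ofNat p.1).toCode (c.curry (Encodable.encode p.2)) :=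
    (OracleCode.primrec_toCode.comp
      (Nat.Partrec.Code.primrec₂_curry.comp (Primrec.const c) (Primrec.encode.comp Primrec.snd))
      Primrec.fst).to_comp
  have := (Nat.Partrec.Code.eval_part.comp hcode (Computable.const 0)).dom_re
  refine this.of_eq fun p => ?_
  rw [OracleCode.eval_toCode, hstr, HaltsOn]

/-- The string of the first `k` values of `X`. -/
def initSeg {A : Type*} (X : ℕ → A) (k : ℕ) : List A := (List.range k).map X

@[simp]
theorem length_initSeg {A : Type*} (X : ℕ → A) (k : ℕ) : (initSeg X k).length = k := by
  simp [initSeg]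

theorem getElem?_initSeg {A : Type*} (X : ℕ → A) {k n : ℕ} (h : n < k) :
    (initSeg X k)[n]? = some (X n) := by
  simp [initSeg, h]

theorem initSeg_succ {A : Type*} (X : ℕ → A) (k : ℕ) :
    initSeg X (k + 1) = initSeg X k ++ [X k] := by
  simp [initSeg, List.range_succ]

theorem oraclePhi_dom_of_haltsOn {e : ℕ} {σ : List ℕ} {X : ℕ → ℕ} (h : HaltsOn e σ)
    (hσ : ∀ k y, σ[k]? = some y → X k = y) : (oraclePhi e X 0).Dom := by
  obtain ⟨y, hy⟩ := Part.dom_iff_mem.1 h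
  refine Part.dom_iff_mem.2 ⟨y, OracleCode.eval_mono (fun n z hz => ?_) _ _ _ hy⟩
  have : σ[n]? = some z := by simpa [stringOracle] using hz
  simp [hσ n z this]

/-- A convergent computation makes finitely many oracle calls. All longer segments are included
because iterated joins produce segments whose length is controlled only from below. -/
theorem exists_haltsOn_initSeg {e : ℕ} {X : ℕ → ℕ} (h : (oraclePhi e X 0).Dom) :
    ∃ k, ∀ l, k ≤ l → HaltsOn e (initSeg X l) := by
  obtain ⟨y, hy⟩ := Part.dom_iff_mem.1 h
  refine Filter.eventually_atTop.1 ?_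
  have hlim : ∀ n y, y ∈ (X : ℕ →. ℕ) n →
      ∀ᶠ k in Filter.atTop, y ∈ stringOracle (initSeg X k) n := by
    intro n y hy
    filter_upwards [Filter.eventually_gt_atTop n] with k hk
    have hy' : y = X n := by simpa using hy
    simp [stringOracle, getElem?_initSeg X hk, hy']
  filter_upwards [OracleCode.eval_eventually hlim _ 0 y hy] with k hk
  exact Part.dom_iff_mem.2 ⟨y, hk⟩

/-! ## Functionals computed by one program for all oracles -/

theorem OracleCode.eval_comp_of_eq {g : ℕ →. ℕ} {c d : OracleCode} {n m : ℕ}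
    (h : d.eval g n = Part.some m) : (comp c d).eval g n = c.eval g m := by
  have : (comp c d).eval g n = Part.bind (d.eval g n) fun x => c.eval g x := rfl
  rw [this, h, Part.bind_some]

theorem OracleCode.exists_code_of_partrec {f : ℕ →. ℕ} (hf : Nat.Partrec f) :
    ∃ c : OracleCode, ∀ g, c.eval g = f := by
  induction hf with
  | zero => exact ⟨zero, fun _ => rfl⟩
  | succ => exact ⟨succ, fun _ => rfl⟩
  | left => exact ⟨left, fun _ => rfl⟩
  | right => exact ⟨right, fun _ => rfl⟩
  | pair _ _ hf hh =>
    obtain ⟨cf, hf⟩ := hf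
    obtain ⟨ch, hh⟩ := hh
    exact ⟨pair cf ch, fun g => by simp only [eval, hf, hh]; rfl⟩
  | comp _ _ hf hh =>
    obtain ⟨cf, hf⟩ := hf
    obtain ⟨ch, hh⟩ := hh
    exact ⟨comp cf ch, fun g => by simp only [eval, hf, hh]; rfl⟩
  | prec _ _ hf hh =>
    obtain ⟨cf, hf⟩ := hf
    obtain ⟨ch, hh⟩ := hh
    exact ⟨prec cf ch, fun g => by funext p; simp only [eval, hf, hh, Nat.unpaired]⟩
  | rfind _ hf =>
    obtain ⟨cf, hf⟩ := hf
    exact ⟨rfind cf, fun g => by funext a; simp only [eval, hf]⟩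

/-- One program computes the total function `F X` from every oracle `X` in `S`. -/
def ComputesOn (S : Set (ℕ → ℕ)) (F : (ℕ → ℕ) → ℕ → ℕ) : Prop :=
  ∃ c : OracleCode, ∀ X ∈ S, ∀ n, c.eval (X : ℕ →. ℕ) n = Part.some (F X n)

namespace ComputesOn

variable {S : Set (ℕ → ℕ)} {F G : (ℕ → ℕ) → ℕ → ℕ}

theorem of_computable {f : ℕ → ℕ} (hf : Computable f) : ComputesOn S fun _ => f := by
  obtain ⟨c, hc⟩ := OracleCode.exists_code_of_partrec (Partrec.nat_iff.1 hf.partrec)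
  exact ⟨c, fun X _ n => by rw [hc]; rfl⟩

theorem oracle : ComputesOn S fun X => X := ⟨.oracle, fun _ _ _ => rfl⟩

theorem comp (hF : ComputesOn S F) (hG : ComputesOn S G) :
    ComputesOn S fun X n => F X (G X n) := by
  obtain ⟨c, hc⟩ := hF
  obtain ⟨d, hd⟩ := hG
  refine ⟨.comp c d, fun X hX n => ?_⟩
  rw [OracleCode.eval_comp_of_eq (hd X hX n), hc X hX]

theorem pair (hF : ComputesOn S F) (hG : ComputesOn S G) :
    ComputesOn S fun X n => Nat.pair (F X n) (G X n) := by
  obtain ⟨c, hc⟩ := hF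
  obtain ⟨d, hd⟩ := hG
  refine ⟨.pair c d, fun X hX n => ?_⟩
  simp [OracleCode.eval, hc X hX, hd X hX, Seq.seq]

theorem prec (hF : ComputesOn S F) (hG : ComputesOn S G) :
    ComputesOn S fun X p => Nat.rec (F X p.unpair.1)
      (fun y i => G X (Nat.pair p.unpair.1 (Nat.pair y i))) p.unpair.2 := by
  obtain ⟨c, hc⟩ := hF
  obtain ⟨d, hd⟩ := hG
  refine ⟨.prec c d, fun X hX p => ?_⟩
  simp only [OracleCode.eval]
  generalize p.unpair.2 = n
  induction n with
  | zero => exact hc X hX _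
  | succ n ih =>
    change Part.bind _ _ = _
    rw [ih, Part.bind_some, hd X hX]

/-- The search has to terminate only for oracles in `S`; this restriction allows a search that is
total for 0' but possibly not for other oracles. -/
theorem rfind (hF : ComputesOn S F) (h : ∀ X ∈ S, ∀ n, ∃ k, F X (Nat.pair n k) = 0) :
    ∃ G, ComputesOn S G ∧ ∀ X ∈ S, ∀ n, F X (Nat.pair n (G X n)) = 0 := by
  classical
  obtain ⟨c, hc⟩ := hF
  refine ⟨fun X n => sInf {k | F X (Nat.pair n k) = 0}, ⟨.rfind c, fun X hX n => ?_⟩,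
    fun X hX n => Nat.sInf_mem (h X hX n)⟩
  refine Part.eq_some_iff.2 (Nat.mem_rfind.2 ⟨?_, fun {m} hm => ?_⟩)
  · have : F X (Nat.pair n (sInf {k | F X (Nat.pair n k) = 0})) = 0 := Nat.sInf_mem (h X hX n)
    rw [hc X hX]
    simpa using this
  · have : ¬ F X (Nat.pair n m) = 0 :=
      Nat.notMem_of_lt_sInf (s := {k | F X (Nat.pair n k) = 0}) hm
    rw [hc X hX]
    simpa using this

theorem initSeg : ComputesOn S fun X n => Encodable.encode (_root_.initSeg X n) := by
  have hsnoc : Computable fun n : ℕ =>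
      Encodable.encode (((Encodable.decode (α := List ℕ) n.unpair.1).getD []) ++ [n.unpair.2]) :=
    (Primrec.encode.comp (Primrec.list_concat.comp
      (Primrec.option_getD.comp (Primrec.decode.comp (Primrec.fst.comp Primrec.unpair))
        (Primrec.const [])) (Primrec.snd.comp Primrec.unpair))).to_comp
  have hl : Computable fun n : ℕ => n.unpair.1 := Computable.fst.comp Computable.unpair
  have hr : Computable fun n : ℕ => n.unpair.2 := Computable.snd.comp Computable.unpair
  have hstep : ComputesOn S fun X n => Encodable.encode
      (((Encodable.decode (α := List ℕ) n.unpair.2.unpair.2).getD []) ++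
        [X n.unpair.2.unpair.1]) := by
    have := (of_computable (S := S) hsnoc).comp ((of_computable (hr.comp hr)).pair
      (oracle.comp (of_computable (hl.comp hr))))
    simpa using this
  have hrec := ((of_computable (S := S) (Computable.const (Encodable.encode ([] : List ℕ)))).prec
    hstep).comp ((of_computable (Computable.const 0)).pair (of_computable Computable.id))
  obtain ⟨c, hc⟩ := hrec
  refine ⟨c, fun X hX n => ?_⟩
  rw [hc X hX]
  congr 1
  simp only [Nat.unpair_pair, id]
  induction n with
  | zero => rfl
  | succ n ih => simp only [ih, Encodable.encodek, initSeg_succ, Option.getD_some]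

end ComputesOn

/-- A class defined by a computable condition on all initial segments is `Π⁰₁`. -/
theorem isPiClass_of_computable {D : ℕ → List ℕ → Bool} (hD : Computable₂ D) :
    IsPiClass {X | ∀ s k, D s (initSeg X k) = true} := by
  let d : ℕ → ℕ := fun n =>
    if D n.unpair.1 ((Encodable.decode (α := List ℕ) n.unpair.2).getD []) then 1 else 0
  have hd : Computable d := by
    have h1 : Computable fun n : ℕ => (Encodable.decode (α := List ℕ) n.unpair.2).getD [] :=
      (Primrec.option_getD.comp (Primrec.decode.comp (Primrec.snd.comp Primrec.unpair))
        (Primrec.const [])).to_comp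
    have := Computable.cond (hD.comp (Computable.fst.comp Computable.unpair) h1)
      (Computable.const 1) (Computable.const 0)
    refine this.of_eq fun n => ?_
    simp only [d]
    cases D n.unpair.1 _ <;> rfl
  have hl : Computable fun n : ℕ => n.unpair.1 := Computable.fst.comp Computable.unpair
  have hr : Computable fun n : ℕ => n.unpair.2 := Computable.snd.comp Computable.unpair
  obtain ⟨c, hc⟩ := (ComputesOn.of_computable (S := Set.univ) hd).comp
    ((ComputesOn.of_computable (hl.comp hr)).pair
      (ComputesOn.initSeg.comp (ComputesOn.of_computable (hr.comp hr))))
  -- The program searches for a code of a pair (s, k) at which the condition fails, so it diverges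
  -- exactly on the members of the class.
  refine ⟨(OracleCode.rfind c).encode, Set.ext fun X => ?_⟩
  simp only [piClass, Set.mem_ofPred_eq, oraclePhi, OracleCode.ofNat_encode]
  have key : (OracleCode.eval (X : ℕ →. ℕ) (OracleCode.rfind c) 0).Dom ↔
      ∃ s k, D s (initSeg X k) = false := by
    simp only [OracleCode.eval, hc X (Set.mem_univ X)]
    refine Nat.rfind_dom.trans ?_
    constructor
    · rintro ⟨n, hn, -⟩
      refine ⟨n.unpair.1, n.unpair.2, ?_⟩
      by_contra hne
      simp [d, hne] at hn
    · rintro ⟨s, k, hsk⟩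
      exact ⟨Nat.pair s k, by simp [d, hsk], fun {m} _ => trivial⟩
  rw [key]
  simp

/-! ## The jump of the zero function -/

/-- A program for the constant function `n`. -/
def OracleCode.const : ℕ → OracleCode
  | 0 => zero
  | n + 1 => comp succ (const n)

theorem OracleCode.eval_const (g : ℕ →. ℕ) (n m : ℕ) : (const n).eval g m = Part.some n := by
  induction n with
  | zero => rfl
  | succ n ih =>
    rw [const, eval_comp_of_eq ih]
    rfl

open Primrec in
theorem OracleCode.primrec_encode_const : Primrec fun n => encode (const n) := by
  -- This is the numbering of `comp`, with 1 the number of `succ`.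
  have h : Primrec₂ fun (_ m : ℕ) => 4 * Nat.pair 1 m + 6 :=
    (nat_add.comp (nat_mul.comp (Primrec.const 4) (Primrec₂.natPair.comp (Primrec.const 1) snd))
      (Primrec.const 6) : Primrec fun p : ℕ × ℕ => 4 * Nat.pair 1 p.2 + 6)
  refine (nat_rec₁ 0 h).of_eq fun n => ?_
  induction n with
  | zero => rfl
  | succ n ih => simp only [ih]; rfl

-- By hard-wiring n, a program is obtained that ignores its oracle and its input and halts exactly
-- when `p n` holds; its number depends computably on n.
open Classical in
theorem exists_zeroJump_eq {p : ℕ → Prop} (hp : REPred p) :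
    ∃ h : ℕ → ℕ, Computable h ∧ ∀ n, zeroJump (h n) = if p n then 1 else 0 := by
  have hf : Partrec fun n => (Part.assert (p n) fun _ => Part.some ()).map fun _ => (0 : ℕ) :=
    Partrec.map hp (Computable.const 0).to₂
  obtain ⟨c, hc⟩ := OracleCode.exists_code_of_partrec (Partrec.nat_iff.1 hf)
  refine ⟨fun n => (OracleCode.comp c (OracleCode.const n)).encode, ?_, fun n => ?_⟩
  · exact (Primrec.nat_add.comp (Primrec.nat_mul.comp (Primrec.const 4)
      (Primrec₂.natPair.comp (Primrec.const c.encode) OracleCode.primrec_encode_const))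
      (Primrec.const 6)).to_comp
  · have : (oraclePhi (OracleCode.comp c (OracleCode.const n)).encode (fun _ => 0) 0).Dom ↔
        p n := by
      rw [oraclePhi, OracleCode.ofNat_encode]
      rw [OracleCode.eval_comp_of_eq (OracleCode.eval_const _ _ _), hc]
      simp [Part.assert]
    simp only [zeroJump, turingJump, this]

/-- A computable function of an argument and of a bound that fails an r.e. condition is computable
from the jump of the zero function. -/
theorem exists_turingReducible_zeroJump {p : ℕ → ℕ → Prop} (hp : REPred fun q : ℕ × ℕ => p q.1 q.2)
    (h : ∀ e, ∃ s, ¬ p e s) {F : ℕ → ℕ → ℕ} (hF : Computable₂ F) :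
    ∃ m : ℕ → ℕ, TuringReducible (m : ℕ →. ℕ) (zeroJump : ℕ →. ℕ) ∧
      ∀ e, ∃ s, ¬ p e s ∧ m e = F e s := by
  classical
  have hp' : REPred fun n : ℕ => p n.unpair.1 n.unpair.2 :=
    Partrec.comp (f := fun q : ℕ × ℕ => Part.assert (p q.1 q.2) fun _ => Part.some ()) hp
      Computable.unpair
  obtain ⟨j, hj, hjump⟩ := exists_zeroJump_eq hp'
  -- The jump takes the value 0 at `j n` exactly when the r.e. condition fails, so an unbounded
  -- search for a zero finds a good bound.
  have hP : ComputesOn {zeroJump} fun X n => X (j n) :=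
    ComputesOn.oracle.comp (.of_computable hj)
  obtain ⟨G, hG, hG0⟩ := hP.rfind (by
    rintro X rfl n
    obtain ⟨s, hs⟩ := h n
    exact ⟨s, by simp [hjump, hs]⟩)
  have hF' : Computable fun n : ℕ => F n.unpair.1 n.unpair.2 :=
    hF.comp (Computable.fst.comp Computable.unpair) (Computable.snd.comp Computable.unpair)
  obtain ⟨c, hc⟩ := (ComputesOn.of_computable hF').comp
    ((ComputesOn.of_computable Computable.id).pair hG)
  refine ⟨fun e => F e (G zeroJump e), ?_, fun e => ⟨G zeroJump e, ?_, rfl⟩⟩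
  · refine (OracleCode.exists_code _ _).2 ⟨c, funext fun n => ?_⟩
    rw [hc _ rfl]
    simp
  · have := hG0 zeroJump rfl e
    rw [hjump] at this
    simpa using this

/-! ## Enumerations of r.e. predicates -/

/-- An index s codes an element together with a bound on the running time. Increasing the bound
repeats the element at arbitrarily late s; this is needed because a candidate may fit the tree only
at late stages. -/
theorem REPred.exists_enumeration {α : Type*} [Primcodable α] {p : α → Prop} (hp : REPred p) :
    ∃ f : ℕ → Option α, Computable f ∧ (∀ s c, f s = some c → p c) ∧
      ∀ c, p c → ∀ s₀, ∃ s, s₀ ≤ s ∧ f s = some c := by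
  have hpart : Partrec fun n : ℕ => ((Encodable.decode (α := α) n : Option α) : Part α).bind
      fun a => (Part.assert (p a) fun _ => Part.some ()).map fun _ => (0 : ℕ) := by
    refine Partrec.bind (Computable.ofOption Computable.decode) ?_
    exact (Partrec.map hp (Computable.const 0).to₂).comp Computable.snd
  obtain ⟨C, hC⟩ := Nat.Partrec.Code.exists_code.1 (Partrec.nat_iff.1 hpart)
  have hdom (a : α) : (C.eval (Encodable.encode a)).Dom ↔ p a := by
    rw [hC]
    simp [Part.assert]
  let f : ℕ → Option α := fun s => (Encodable.decode (α := α) s.unpair.1).bind fun a =>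
    if (Nat.Partrec.Code.evaln s.unpair.2 C (Encodable.encode a)).isSome then some a else none
  refine ⟨f, ?_, ?_, ?_⟩
  · refine Primrec.to_comp ?_
    refine Primrec.option_bind
      (Primrec.decode.comp (Primrec.fst.comp Primrec.unpair)) ?_
    have hev : Primrec fun p : ℕ × α =>
        Nat.Partrec.Code.evaln p.1.unpair.2 C (Encodable.encode p.2) :=
      Nat.Partrec.Code.primrec_evaln.comp
        (((Primrec.snd.comp (Primrec.unpair.comp Primrec.fst)).pair (Primrec.const C)).pair
          (Primrec.encode.comp Primrec.snd))
    exact Primrec.ite (Primrec.eq.comp (Primrec.option_isSome.comp hev) (Primrec.const true))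
      (Primrec.option_some.comp Primrec.snd) (Primrec.const none)
  · intro s c hc
    obtain ⟨a, -, ha⟩ := Option.bind_eq_some_iff.1 hc
    split_ifs at ha with h
    obtain ⟨y, hy⟩ := Option.isSome_iff_exists.1 h
    rw [← Option.some.inj ha, ← hdom]
    exact Part.dom_iff_mem.2 ⟨y, Nat.Partrec.Code.evaln_sound hy⟩
  · intro c hc s₀
    obtain ⟨y, hy⟩ := Part.dom_iff_mem.1 ((hdom c).2 hc)
    obtain ⟨k, hk⟩ := Nat.Partrec.Code.evaln_complete.1 hy
    refine ⟨Nat.pair (Encodable.encode c) (max k s₀),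
      (le_max_right _ _).trans (Nat.right_le_pair _ _), ?_⟩
    have := Nat.Partrec.Code.evaln_mono (le_max_left k s₀) hk
    simp [f, Option.mem_def.1 this]

theorem REPred.comp {α β : Type*} [Primcodable α] [Primcodable β] {p : β → Prop} (hp : REPred p)
    {f : α → β} (hf : Computable f) : REPred fun a => p (f a) :=
  Partrec.comp (f := fun b => Part.assert (p b) fun _ => Part.some ()) hp hf

theorem Computable₂.rePred_exists {α : Type*} [Primcodable α] {D : α → ℕ → Bool}
    (hD : Computable₂ D) : REPred fun a => ∃ n, D a n = true := by
  have : Partrec fun a => Nat.rfind fun n => (D a n : Part Bool) := Partrec.rfind hD.partrec₂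
  refine this.dom_re.of_eq fun a => ?_
  refine Nat.rfind_dom.trans ⟨?_, ?_⟩
  · rintro ⟨n, hn, -⟩
    exact ⟨n, (Part.mem_some_iff.1 hn).symm⟩
  · rintro ⟨n, hn⟩
    exact ⟨n, by simp [hn], fun {m} _ => trivial⟩

/-! ## The construction -/

/-- The interleaving of two strings. -/
def joinString (σ τ : List Bool) : List Bool :=
  (List.range (2 * min σ.length τ.length)).map fun k =>
    if k % 2 = 0 then σ.getD (k / 2) false else τ.getD (k / 2) false

/-- The iterated interleaving of a list of strings, associated to the left. -/
def joinStrings (l : List (List Bool)) : List Bool := l.tail.foldl joinString l.headI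

/-- The entries of `A` at the indices in `I`. -/
def selectEntries (A : List (List Bool)) (I : List ℕ) : List (List Bool) := I.map fun i => A.getD i []

/-- A stage of the construction: a finite list of levels.  A level consists of a list of strings,
and of a list of those pairs of an index `e` and a list of entry numbers for which the product of the
corresponding neighbourhoods is known to be disjoint from `piClass e`. -/
abbrev TreeStage : Type := List (List (List Bool) × List (ℕ × List ℕ))

/-- A level number, a list of strings to replace the strings of this level, an index, and a list of
entry numbers. -/
abbrev Candidate : Type := ℕ × List (List Bool) × ℕ × List ℕ

namespace TreeStage

/-- The strings of level `j`. -/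
def strings (S : TreeStage) (j : ℕ) : List (List Bool) := (S.getD j ([], [])).1

/-- The pairs that have been dealt with at level `j`. -/
def settled (S : TreeStage) (j : ℕ) : List (ℕ × List ℕ) := (S.getD j ([], [])).2

/-- The strings of the last level. -/
def top (S : TreeStage) : List (List Bool) := S.strings (S.length - 1)

/-- The first string of the last level that extends `σ`. -/
def pick (S : TreeStage) (σ : List Bool) : List Bool :=
  S.top.getD (S.top.findIdx fun τ => decide (σ <+: τ)) []

/-- The immediate successors of the strings in `A`. -/
def children (A : List (List Bool)) : List (List Bool) :=
  A.flatMap fun τ => [τ ++ [false], τ ++ [true]]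

/-- Add a level. -/
def grow (S : TreeStage) : TreeStage := S ++ [(children S.top, [])]

/-- Replace the level of a candidate, and discard all later levels. -/
def act (S : TreeStage) (c : Candidate) : TreeStage :=
  S.take c.1 ++ [(c.2.1.map S.pick, c.2.2 :: S.settled c.1)]

/-- The conditions for replacing a level. -/
def Eligible (S : TreeStage) (c : Candidate) : Prop :=
  c.1 < S.length ∧ c.2.2.1 ≤ c.1 ∧ c.2.2.2.length ≤ (S.strings c.1).length ∧
    (∀ i ∈ c.2.2.2, i < (S.strings c.1).length) ∧ c.2.2 ∉ S.settled c.1 ∧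
    (∀ σ ∈ c.2.1, ∃ τ ∈ S.top, σ <+: τ) ∧ (S.strings c.1).length = c.2.1.length ∧
    ∀ i < c.2.1.length, (S.strings c.1).getD i [] <+: (c.2.1.map S.pick).getD i []

open Classical in
/-- One step of the construction. -/
noncomputable def step (S : TreeStage) (c : Option Candidate) : TreeStage :=
  c.elim S.grow fun c => if S.Eligible c then S.act c else S.grow

/-- The stages of the construction for a given sequence of candidates. -/
noncomputable def stage (f : ℕ → Option Candidate) : ℕ → TreeStage
  | 0 => [([[]], [])]
  | s + 1 => (stage f s).step (f s)

end TreeStage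

/-! ### Computability of the construction -/

open Primrec in
theorem primrecRel_isPrefix : PrimrecRel fun σ τ : List Bool => σ <+: τ :=
  PrimrecPred.of_eq (Primrec.eq.comp fst (list_take.comp (list_length.comp fst) snd))
    fun _ => List.prefix_iff_eq_take.symm

open Primrec in
theorem primrec₂_joinString : Primrec₂ joinString := by
  have hhalf : Primrec fun q : (List Bool × List Bool) × ℕ => q.2 / 2 :=
    nat_div.comp snd (const 2)
  refine list_map (list_range.comp (nat_mul.comp (const 2) (nat_min.comp (list_length.comp fst)
    (list_length.comp snd)))) ?_
  exact Primrec.ite (Primrec.eq.comp (nat_mod.comp snd (const 2)) (const 0))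
    ((list_getD false).comp (fst.comp fst) hhalf) ((list_getD false).comp (snd.comp fst) hhalf)

open Primrec in
theorem primrec_joinStrings : Primrec joinStrings :=
  list_foldl list_tail list_headI (primrec₂_joinString.comp (fst.comp snd) (snd.comp snd)).to₂

open Primrec in
theorem primrec₂_selectEntries : Primrec₂ selectEntries :=
  list_map snd ((list_getD []).comp (fst.comp fst) snd)

open Primrec in
theorem primrec_oracle_of_candidate : Primrec fun c : Candidate =>
    (c.2.2.1, (joinStrings (selectEntries c.2.1 c.2.2.2)).map Bool.toNat) := by
  have h1 : Primrec fun c : Candidate => c.2.2.1 := fst.comp (snd.comp snd)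
  have h2 : Primrec fun c : Candidate => selectEntries c.2.1 c.2.2.2 :=
    primrec₂_selectEntries.comp (fst.comp snd) (snd.comp (snd.comp snd))
  have h3 : Primrec fun σ : List Bool => σ.map Bool.toNat :=
    list_map .id ((dom_finite Bool.toNat).comp snd)
  exact h1.pair (h3.comp (primrec_joinStrings.comp h2))

theorem REPred.haltsOn_comp {f : Candidate → ℕ × List ℕ} (hf : Primrec f) :
    REPred fun c => HaltsOn (f c).1 (f c).2 :=
  rePred_haltsOn.comp hf.to_comp

theorem rePred_haltsOn_candidate : REPred fun c : Candidate =>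
    HaltsOn c.2.2.1 ((joinStrings (selectEntries c.2.1 c.2.2.2)).map Bool.toNat) :=
  REPred.haltsOn_comp
    (f := fun c => (c.2.2.1, (joinStrings (selectEntries c.2.1 c.2.2.2)).map Bool.toNat))
    primrec_oracle_of_candidate

namespace TreeStage

open Primrec

theorem primrec₂_strings : Primrec₂ strings :=
  fst.comp ((list_getD _).comp fst snd)

theorem primrec₂_settled : Primrec₂ settled :=
  snd.comp ((list_getD _).comp fst snd)

theorem primrec_top : Primrec top :=
  primrec₂_strings.comp .id (nat_sub.comp list_length (const 1))

theorem primrec₂_pick : Primrec₂ pick := by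
  refine (list_getD []).comp (primrec_top.comp fst) (list_findIdx (primrec_top.comp fst) ?_)
  exact (primrecRel_isPrefix.comp (snd.comp fst) snd).decide

theorem primrec_children : Primrec children := by
  have h (b : Bool) : Primrec fun p : List (List Bool) × List Bool => p.2 ++ [b] :=
    list_concat.comp snd (const b)
  exact list_flatMap .id (list_cons.comp (h false) (list_cons.comp (h true) (const [])))

theorem primrec_grow : Primrec grow :=
  list_concat.comp .id ((primrec_children.comp primrec_top).pair (const []))

theorem primrec_map_pick : Primrec fun p : TreeStage × Candidate => p.2.2.1.map p.1.pick :=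
  list_map (fst.comp (snd.comp snd)) (primrec₂_pick.comp (fst.comp fst) snd)

theorem primrec₂_act : Primrec₂ act :=
  list_concat.comp (list_take.comp (fst.comp snd) fst) (primrec_map_pick.pair
    (list_cons.comp (snd.comp (snd.comp snd)) (primrec₂_settled.comp fst (fst.comp snd))))

theorem primrecRel_mem {α : Type*} [Primcodable α] :
    PrimrecRel fun (a : α) (l : List α) => a ∈ l := by
  have h : PrimrecRel fun (l : List α) (a : α) => ∃ b ∈ l, b = a :=
    PrimrecRel.exists_mem_list Primrec.eq
  exact PrimrecPred.of_eq (h.comp snd fst) fun p => by simp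

theorem primrecRel_eligible : PrimrecRel Eligible := by
  have hA : Primrec fun p : TreeStage × Candidate => p.1.strings p.2.1 :=
    primrec₂_strings.comp fst (fst.comp snd)
  have hlen : Primrec fun p : TreeStage × Candidate => (p.1.strings p.2.1).length :=
    list_length.comp hA
  have hI : Primrec fun p : TreeStage × Candidate => p.2.2.2.2 :=
    snd.comp (snd.comp (snd.comp snd))
  have hlt : PrimrecRel fun (l : List ℕ) (n : ℕ) => ∀ i ∈ l, i < n :=
    PrimrecRel.forall_mem_list nat_lt
  have hex : PrimrecRel fun (σ : List Bool) (l : List (List Bool)) => ∃ τ ∈ l, σ <+: τ := by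
    have h : PrimrecRel fun (l : List (List Bool)) (σ : List Bool) => ∃ τ ∈ l, σ <+: τ :=
      PrimrecRel.exists_mem_list (primrecRel_isPrefix.comp snd fst)
    exact h.comp snd fst
  have hmem : PrimrecRel fun (l l' : List (List Bool)) => ∀ σ ∈ l, ∃ τ ∈ l', σ <+: τ :=
    PrimrecRel.forall_mem_list hex
  have hpre : PrimrecRel fun (n : ℕ) (p : TreeStage × Candidate) => ∀ i < n,
      (p.1.strings p.2.1).getD i [] <+: (p.2.2.1.map p.1.pick).getD i [] := by
    have h : PrimrecRel fun (i : ℕ) (p : TreeStage × Candidate) =>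
        (p.1.strings p.2.1).getD i [] <+: (p.2.2.1.map p.1.pick).getD i [] :=
      primrecRel_isPrefix.comp ((list_getD []).comp (hA.comp snd) fst)
        ((list_getD []).comp (primrec_map_pick.comp snd) fst)
    exact PrimrecPred.of_eq (h.forall_mem_list.comp (list_range.comp fst) snd) fun p => by simp
  refine .and (nat_lt.comp (fst.comp snd) (list_length.comp fst)) ?_
  refine .and (nat_le.comp (fst.comp (snd.comp (snd.comp snd))) (fst.comp snd)) ?_
  refine .and (nat_le.comp (list_length.comp hI) hlen) ?_
  refine .and (hlt.comp hI hlen) ?_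
  refine .and (primrecRel_mem.comp (snd.comp (snd.comp snd))
    (primrec₂_settled.comp fst (fst.comp snd))).not ?_
  refine .and (hmem.comp (fst.comp (snd.comp snd)) (primrec_top.comp fst)) ?_
  have hlen' : Primrec fun p : TreeStage × Candidate => p.2.2.1.length :=
    list_length.comp (fst.comp (snd.comp snd))
  exact .and (Primrec.eq.comp hlen hlen') (hpre.comp hlen' .id)

theorem primrec₂_step : Primrec₂ step := by
  classical
  have h : Primrec₂ fun (p : TreeStage × Option Candidate) (c : Candidate) =>
      if p.1.Eligible c then p.1.act c else p.1.grow :=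
    Primrec.ite (primrecRel_eligible.comp (fst.comp fst) snd)
      (primrec₂_act.comp (fst.comp fst) snd) (primrec_grow.comp (fst.comp fst))
  refine (option_casesOn snd (primrec_grow.comp fst) h).of_eq fun p => ?_
  rcases p with ⟨S, _ | c⟩
  · rfl
  · simp only [step, Option.elim]

theorem computable_stage {f : ℕ → Option Candidate} (hf : Computable f) : Computable (stage f) := by
  have h : Computable₂ fun (_ : ℕ) (p : ℕ × TreeStage) => p.2.step (f p.1) :=
    primrec₂_step.to_comp.comp (Computable.snd.comp Computable.snd)
      (hf.comp (Computable.fst.comp Computable.snd))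
  refine (Computable.nat_rec Computable.id (Computable.const [([[]], [])]) h).of_eq fun s => ?_
  simp only [id]
  induction s with
  | zero => rfl
  | succ s ih => simp only [ih, stage]

end TreeStage

/-! ## Neighbourhoods and joins -/

theorem mem_stringNhd_iff {τ : List Bool} {X : ℕ → Bool} :
    X ∈ stringNhd τ ↔ ∀ k y, τ[k]? = some y → X k = y := by
  constructor
  · intro h k y hk
    obtain ⟨hlt, rfl⟩ := List.getElem?_eq_some_iff.1 hk
    exact h k hlt
  · intro h k hk
    exact h k _ (List.getElem?_eq_getElem hk)

theorem stringNhd_anti {σ τ : List Bool} (h : σ <+: τ) : stringNhd τ ⊆ stringNhd σ := by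
  intro X hX
  rw [mem_stringNhd_iff] at hX ⊢
  intro k y hk
  refine hX k y ?_
  obtain ⟨ρ, rfl⟩ := h
  obtain ⟨hlt, -⟩ := List.getElem?_eq_some_iff.1 hk
  rw [List.getElem?_append_left hlt, hk]

theorem mem_stringNhd_nil (X : ℕ → Bool) : X ∈ stringNhd [] := by
  rw [mem_stringNhd_iff]
  simp

theorem mem_stringNhd_iff_initSeg {τ : List Bool} {X : ℕ → Bool} :
    X ∈ stringNhd τ ↔ initSeg X τ.length = τ := by
  constructor
  · intro h
    refine List.ext_getElem (by simp) fun k h1 h2 => ?_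
    simpa [initSeg] using h k h2
  · intro h k hk
    have : (initSeg X τ.length)[k]? = τ[k]? := by rw [h]
    rw [getElem?_initSeg X hk, List.getElem?_eq_getElem hk] at this
    exact Option.some.inj this

theorem initSeg_take {A : Type*} (X : ℕ → A) {k l : ℕ} (h : k ≤ l) :
    (initSeg X l).take k = initSeg X k := by
  rw [initSeg, ← List.map_take, List.take_range, min_eq_left h, initSeg]

theorem mem_stringNhd_initSeg (X : ℕ → Bool) (k : ℕ) : X ∈ stringNhd (initSeg X k) := by
  rw [mem_stringNhd_iff_initSeg, length_initSeg]

theorem initSeg_prefix_of_mem {X : ℕ → Bool} {τ : List Bool} (h : X ∈ stringNhd τ) {k : ℕ}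
    (hk : k ≤ τ.length) : initSeg X k <+: τ := by
  rw [← mem_stringNhd_iff_initSeg.1 h, ← initSeg_take X hk]
  exact List.take_prefix _ _

theorem prefix_initSeg_of_mem {X : ℕ → Bool} {τ : List Bool} (h : X ∈ stringNhd τ) {k : ℕ}
    (hk : τ.length ≤ k) : τ <+: initSeg X k := by
  rw [← mem_stringNhd_iff_initSeg.1 h, ← initSeg_take X hk]
  exact List.take_prefix _ _

/-- The iterated join of a list of sequences, associated to the left. -/
def joinSeqs (l : List (ℕ → Bool)) : ℕ → Bool := l.tail.foldl seqJoin l.headI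

theorem joinSeqs_concat {l : List (ℕ → Bool)} (hl : l ≠ []) (X : ℕ → Bool) :
    joinSeqs (l ++ [X]) = seqJoin (joinSeqs l) X := by
  cases l with
  | nil => exact absurd rfl hl
  | cons a l => simp [joinSeqs]

theorem joinSeqs_ofFn_succ (n : ℕ) (X : Fin (n + 2) → ℕ → Bool) :
    joinSeqs (List.ofFn X) =
      seqJoin (joinSeqs (List.ofFn fun i => X i.castSucc)) (X (Fin.last (n + 1))) := by
  rw [List.ofFn_succ', List.concat_eq_append, joinSeqs_concat]
  exact List.ne_nil_of_length_pos (by simp)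

/-- Both sides associate to the left, so the recursive product becomes a fold over a list, parallel
to the fold that joins strings. -/
theorem mem_classProdN_succ (n : ℕ) (S : Fin (n + 1) → Set (ℕ → Bool)) (Z : ℕ → Bool) :
    Z ∈ classProdN (n + 1) S ↔
      ∃ X : Fin (n + 1) → ℕ → Bool, (∀ i, X i ∈ S i) ∧ Z = joinSeqs (List.ofFn X) := by
  induction n generalizing Z with
  | zero =>
    constructor
    · intro h
      exact ⟨fun _ => Z, fun i => by rw [Fin.fin_one_eq_zero i]; exact h, by simp [joinSeqs]⟩
    · rintro ⟨X, hX, rfl⟩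
      have : joinSeqs (List.ofFn X) = X 0 := by simp [joinSeqs]
      rw [this]
      exact hX 0
  | succ n ih =>
    constructor
    · rintro ⟨Y, hY, W, hW, rfl⟩
      obtain ⟨X, hX, rfl⟩ := (ih _ _).1 hY
      refine ⟨Fin.snoc (α := fun _ => ℕ → Bool) X W, fun i => ?_, ?_⟩
      · induction i using Fin.lastCases with
        | last => simpa using hW
        | cast i => simpa using hX i
      · rw [joinSeqs_ofFn_succ]
        simp only [Fin.snoc_castSucc, Fin.snoc_last]
    · rintro ⟨X, hX, rfl⟩
      refine ⟨joinSeqs (List.ofFn fun i => X i.castSucc), (ih _ _).2 ⟨_, fun i => hX _, rfl⟩,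
        X (Fin.last _), hX _, joinSeqs_ofFn_succ n X⟩

theorem seqJoin_mem_stringNhd {σ τ : List Bool} {X Y : ℕ → Bool} (hX : X ∈ stringNhd σ)
    (hY : Y ∈ stringNhd τ) : seqJoin X Y ∈ stringNhd (joinString σ τ) := by
  intro k hk
  have hk' : k < 2 * min σ.length τ.length := by simpa [joinString] using hk
  have h1 : k / 2 < σ.length := by omega
  have h2 : k / 2 < τ.length := by omega
  simp only [joinString, List.getElem_map, List.getElem_range, seqJoin, List.getD_eq_getElem _ _ h1,
    List.getD_eq_getElem _ _ h2, hX _ h1, hY _ h2]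

/-- This makes a halting computation on the joined string valid for every member of the product of
the cones. -/
theorem joinSeqs_mem_stringNhd {Xs : List (ℕ → Bool)} {l : List (List Bool)}
    (h : List.Forall₂ (fun X σ => X ∈ stringNhd σ) Xs l) :
    joinSeqs Xs ∈ stringNhd (joinStrings l) := by
  have key : ∀ (Xs : List (ℕ → Bool)) (l : List (List Bool)) (X : ℕ → Bool) (σ : List Bool),
      List.Forall₂ (fun X σ => X ∈ stringNhd σ) Xs l → X ∈ stringNhd σ →
        Xs.foldl seqJoin X ∈ stringNhd (l.foldl joinString σ) := by
    intro Xs l X σ h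
    induction h generalizing X σ with
    | nil => exact id
    | cons h1 _ ih => exact fun h => ih _ _ (seqJoin_mem_stringNhd h h1)
  cases h with
  | nil => exact mem_stringNhd_nil _
  | cons h1 h2 => exact key _ _ _ _ h2 h1

theorem joinString_initSeg (X Y : ℕ → Bool) (k l : ℕ) :
    joinString (initSeg X k) (initSeg Y l) = initSeg (seqJoin X Y) (2 * min k l) := by
  have h := seqJoin_mem_stringNhd (mem_stringNhd_initSeg X k) (mem_stringNhd_initSeg Y l)
  rw [mem_stringNhd_iff_initSeg] at h
  rw [← h]
  simp [joinString]

/-- Each join of segments of lengths m ≥ k and k has length 2k, so the length never drops below k.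
-/
theorem exists_joinStrings_initSeg {Xs : List (ℕ → Bool)} (hXs : Xs ≠ []) (k : ℕ) :
    ∃ l, k ≤ l ∧ joinStrings (Xs.map fun X => initSeg X k) = initSeg (joinSeqs Xs) l := by
  have key : ∀ (Xs : List (ℕ → Bool)) (X : ℕ → Bool) (m : ℕ), k ≤ m → ∃ l, k ≤ l ∧
      (Xs.map fun X => initSeg X k).foldl joinString (initSeg X m) =
        initSeg (Xs.foldl seqJoin X) l := by
    intro Xs
    induction Xs with
    | nil => exact fun X m hm => ⟨m, hm, rfl⟩
    | cons Y Xs ih =>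
      intro X m hm
      simp only [List.map_cons, List.foldl_cons, joinString_initSeg]
      exact ih _ _ (by omega)
  cases Xs with
  | nil => exact absurd rfl hXs
  | cons X Xs => exact key Xs X k le_rfl

/-! ## Pointwise extensions of lists of strings -/

/-- Every string of `A'` extends the corresponding string of `A`. -/
abbrev Extends (A A' : List (List Bool)) : Prop := List.Forall₂ (· <+: ·) A A'

namespace Extends

variable {A A' A'' : List (List Bool)}

protected theorem refl (A : List (List Bool)) : Extends A A :=
  List.forall₂_same.2 fun σ _ => List.prefix_refl σ

protected theorem trans (h : Extends A A') (h' : Extends A' A'') : Extends A A'' := by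
  induction h generalizing A'' with
  | nil => exact h'
  | cons h1 _ ih =>
    cases h' with
    | cons h3 h4 => exact .cons (h1.trans h3) (ih h4)

theorem getD_prefix (h : Extends A A') (i : ℕ) : A.getD i [] <+: A'.getD i [] := by
  induction h generalizing i with
  | nil => simp
  | cons h1 _ ih =>
    cases i with
    | zero => simpa using h1
    | succ i => simpa using ih i

theorem of_getD_prefix (hlen : A.length = A'.length)
    (h : ∀ i < A'.length, A.getD i [] <+: A'.getD i []) : Extends A A' := by
  refine List.forall₂_iff_get.2 ⟨hlen, fun i h1 h2 => ?_⟩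
  have := h i h2
  rwa [List.getD_eq_getElem _ _ h1, List.getD_eq_getElem _ _ h2] at this

theorem exists_left (h : Extends A A') {τ : List Bool} (hτ : τ ∈ A') : ∃ σ ∈ A, σ <+: τ := by
  induction h with
  | nil => simp at hτ
  | cons h1 _ ih =>
    rcases List.mem_cons.1 hτ with rfl | hτ
    · exact ⟨_, List.mem_cons_self, h1⟩
    · obtain ⟨σ, hσ, hp⟩ := ih hτ
      exact ⟨σ, List.mem_cons_of_mem _ hσ, hp⟩

theorem exists_right (h : Extends A A') {σ : List Bool} (hσ : σ ∈ A) : ∃ τ ∈ A', σ <+: τ := by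
  induction h with
  | nil => simp at hσ
  | cons h1 _ ih =>
    rcases List.mem_cons.1 hσ with rfl | hσ
    · exact ⟨_, List.mem_cons_self, h1⟩
    · obtain ⟨τ, hτ, hp⟩ := ih hσ
      exact ⟨τ, List.mem_cons_of_mem _ hτ, hp⟩

/-- Truncation recovers the children of a level from the next level, so distinctness passes upwards
through the tree. -/
theorem map_take (h : Extends A A') {n : ℕ} (hA : ∀ σ ∈ A, σ.length = n) :
    A'.map (List.take n) = A := by
  induction h with
  | nil => rfl
  | @cons σ τ _ _ h1 _ ih =>
    rw [List.map_cons, ih fun σ hσ => hA σ (List.mem_cons_of_mem _ hσ)]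
    congr 1
    rw [← hA σ List.mem_cons_self]
    exact (List.prefix_iff_eq_take.1 h1).symm

end Extends

namespace TreeStage

theorem mem_children {A : List (List Bool)} {σ : List Bool} :
    σ ∈ children A ↔ ∃ τ ∈ A, ∃ b, σ = τ ++ [b] := by
  simp [children]

theorem length_children (A : List (List Bool)) : (children A).length = 2 * A.length := by
  simp [children, mul_comm]

theorem nodup_children {A : List (List Bool)} (h : A.Nodup) : (children A).Nodup := by
  rw [children, List.nodup_flatMap]
  refine ⟨fun σ _ => by simp, h.imp fun {σ τ} hne => ?_⟩
  simp only [Function.onFun, List.disjoint_left]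
  intro ρ h1 h2
  simp only [List.mem_cons, List.not_mem_nil, or_false] at h1 h2
  rcases h1 with rfl | rfl <;> rcases h2 with h2 | h2 <;>
    exact hne (List.append_inj_left' h2 rfl)

end TreeStage

/-- The class of all sequences that extend some member of `A`. -/
def coverOf (A : List (List Bool)) : Set (ℕ → Bool) := {X | ∃ σ ∈ A, X ∈ stringNhd σ}

theorem coverOf_anti {A A' : List (List Bool)} (h : ∀ τ ∈ A', ∃ σ ∈ A, σ <+: τ) :
    coverOf A' ⊆ coverOf A := by
  rintro X ⟨τ, hτ, hX⟩
  obtain ⟨σ, hσ, hp⟩ := h τ hτ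
  exact ⟨σ, hσ, stringNhd_anti hp hX⟩

theorem coverOf_children (A : List (List Bool)) : coverOf (TreeStage.children A) = coverOf A := by
  refine Set.Subset.antisymm (coverOf_anti fun τ hτ => ?_) ?_
  · obtain ⟨σ, hσ, b, rfl⟩ := TreeStage.mem_children.1 hτ
    exact ⟨σ, hσ, List.prefix_append _ _⟩
  · rintro X ⟨σ, hσ, hX⟩
    refine ⟨initSeg X (σ.length + 1), TreeStage.mem_children.2 ⟨σ, hσ, X σ.length, ?_⟩,
      mem_stringNhd_initSeg _ _⟩
    rw [initSeg_succ, mem_stringNhd_iff_initSeg.1 hX]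

/-! ## Perfect trees given by levels -/

/-- A perfect binary tree given by its branching levels. -/
structure IsTreeSequence (B : ℕ → List (List Bool)) : Prop where
  zero : Extends [[]] (B 0)
  succ : ∀ j, Extends (TreeStage.children (B j)) (B (j + 1))
  uniform : ∀ j, ∃ n, ∀ σ ∈ B j, σ.length = n

/-- The class of all paths through a tree given by its branching levels. -/
def pathsOf (B : ℕ → List (List Bool)) : Set (ℕ → Bool) := {X | ∀ j, X ∈ coverOf (B j)}

/-- The length of the strings of level `j`. -/
def levelLength (B : ℕ → List (List Bool)) (j : ℕ) : ℕ := (B j).headI.length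

/-! ### Closedness of the class of paths -/

theorem isClosed_stringNhd (σ : List Bool) : IsClosed (stringNhd σ) := by
  have : stringNhd σ = ⋂ (k : ℕ) (hk : k < σ.length), {X | X k = σ[k]} := by
    ext X
    simp [stringNhd]
  rw [this]
  exact isClosed_iInter fun k => isClosed_iInter fun hk =>
    isClosed_eq (continuous_apply k) continuous_const

theorem isClosed_coverOf (A : List (List Bool)) : IsClosed (coverOf A) := by
  have : coverOf A = ⋃ σ ∈ {σ | σ ∈ A}, stringNhd σ := by
    ext X
    simp [coverOf]
  rw [this]
  exact Set.Finite.isClosed_biUnion (List.finite_toSet A) fun σ _ => isClosed_stringNhd σ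

theorem isClosed_pathsOf (B : ℕ → List (List Bool)) : IsClosed (pathsOf B) := by
  have : pathsOf B = ⋂ j, coverOf (B j) := by
    ext X
    simp [pathsOf]
  rw [this]
  exact isClosed_iInter fun j => isClosed_coverOf _

namespace IsTreeSequence

variable {B : ℕ → List (List Bool)} (hB : IsTreeSequence B)

include hB

theorem length_eq (j : ℕ) : (B j).length = 2 ^ j := by
  induction j with
  | zero => simpa using hB.zero.length_eq.symm
  | succ j ih => rw [← (hB.succ j).length_eq, TreeStage.length_children, ih, pow_succ']

theorem ne_nil (j : ℕ) : B j ≠ [] := by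
  intro h
  have := hB.length_eq j
  rw [h] at this
  exact absurd this.symm (pow_pos two_pos j).ne'

theorem length_of_mem {j : ℕ} {σ : List Bool} (hσ : σ ∈ B j) : σ.length = levelLength B j := by
  obtain ⟨n, hn⟩ := hB.uniform j
  have : (B j).headI ∈ B j := by
    cases h : B j with
    | nil => exact absurd h (hB.ne_nil j)
    | cons a l => simp
  rw [hn σ hσ, levelLength, hn _ this]

theorem length_of_mem_children {j : ℕ} {σ : List Bool} (hσ : σ ∈ TreeStage.children (B j)) :
    σ.length = levelLength B j + 1 := by
  obtain ⟨τ, hτ, b, rfl⟩ := TreeStage.mem_children.1 hσ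
  simp [hB.length_of_mem hτ]

theorem levelLength_lt_succ (j : ℕ) : levelLength B j < levelLength B (j + 1) := by
  obtain ⟨σ, hσ⟩ := List.exists_mem_of_ne_nil _ (hB.ne_nil (j + 1))
  obtain ⟨τ, hτ, hp⟩ := (hB.succ j).exists_left hσ
  have := hp.length_le
  rw [hB.length_of_mem_children hτ, hB.length_of_mem hσ] at this
  exact this

theorem strictMono_levelLength : StrictMono (levelLength B) :=
  strictMono_nat_of_lt_succ hB.levelLength_lt_succ

theorem nodup (j : ℕ) : (B j).Nodup := by
  induction j with
  | zero =>
    have h := hB.length_eq 0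
    obtain ⟨σ, hσ⟩ := List.length_eq_one_iff.1 h
    simp [hσ]
  | succ j ih =>
    refine List.Nodup.of_map (List.take (levelLength B j + 1)) ?_
    rw [(hB.succ j).map_take fun σ hσ => hB.length_of_mem_children hσ]
    exact TreeStage.nodup_children ih

/-- Distinct strings of level j+1 extend distinct children of level j, so they already differ within
the first `levelLength B j + 1` bits. -/
theorem eq_of_take_eq {j : ℕ} {σ τ : List Bool} (hσ : σ ∈ B (j + 1)) (hτ : τ ∈ B (j + 1))
    (h : σ.take (levelLength B j + 1) = τ.take (levelLength B j + 1)) : σ = τ := by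
  refine List.inj_on_of_nodup_map ?_ hσ hτ h
  rw [(hB.succ j).map_take fun σ hσ => hB.length_of_mem_children hσ]
  exact TreeStage.nodup_children (hB.nodup j)

theorem exists_succ_of_mem {j : ℕ} {σ : List Bool} (hσ : σ ∈ B j) (b : Bool) :
    ∃ τ ∈ B (j + 1), σ ++ [b] <+: τ :=
  (hB.succ j).exists_right (TreeStage.mem_children.2 ⟨σ, hσ, b, rfl⟩)

theorem antitone_coverOf : Antitone fun j => coverOf (B j) := by
  refine antitone_nat_of_succ_le fun j => coverOf_anti fun τ hτ => ?_
  obtain ⟨ρ, hρ, hp⟩ := (hB.succ j).exists_left hτ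
  obtain ⟨σ, hσ, b, rfl⟩ := TreeStage.mem_children.1 hρ
  exact ⟨σ, hσ, (List.prefix_append _ _).trans hp⟩

/-- Following the `false` child from level to level gives an increasing chain of strings; the nth
has length at least n, so bit k can be read off from number k+1. -/
theorem exists_path {j : ℕ} {σ : List Bool} (hσ : σ ∈ B j) :
    ∃ X ∈ pathsOf B, X ∈ stringNhd σ := by
  choose F hF hFp using fun (j : ℕ) (σ : {σ // σ ∈ B j}) => hB.exists_succ_of_mem σ.2 false
  let s : (n : ℕ) → {σ // σ ∈ B (j + n)} := fun n =>
    Nat.rec ⟨σ, hσ⟩ (fun n τ => ⟨F (j + n) τ, hF (j + n) τ⟩) n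
  have hs (n : ℕ) : (s n).1 <+: (s (n + 1)).1 := (List.prefix_append _ _).trans (hFp (j + n) (s n))
  have hmono {m n : ℕ} (h : m ≤ n) : (s m).1 <+: (s n).1 := by
    induction n, h using Nat.le_induction with
    | base => exact List.prefix_refl _
    | succ n _ ih => exact ih.trans (hs n)
  have hlen (n : ℕ) : n ≤ (s n).1.length := by
    rw [hB.length_of_mem (s n).2]
    exact (Nat.le_add_left n j).trans (hB.strictMono_levelLength.le_apply)
  have hget (k n : ℕ) (h : k < (s n).1.length) :
      (s (k + 1)).1.getD k false = (s n).1[k] := by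
    have h1 : k < (s (k + 1)).1.length := hlen (k + 1)
    rw [List.getD_eq_getElem _ _ h1]
    rcases le_total (k + 1) n with hn | hn
    · exact (hmono hn).getElem h1
    · exact ((hmono hn).getElem h).symm
  have hmem (n : ℕ) : (fun k => (s (k + 1)).1.getD k false) ∈ stringNhd (s n).1 :=
    fun k hk => hget k n hk
  refine ⟨fun k => (s (k + 1)).1.getD k false, fun i => ?_, hmem 0⟩
  exact hB.antitone_coverOf (Nat.le_add_left i j) ⟨(s i).1, (s i).2, hmem i⟩

theorem nonempty_pathsOf : (pathsOf B).Nonempty := by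
  obtain ⟨σ, hσ⟩ := List.exists_mem_of_ne_nil _ (hB.ne_nil 0)
  obtain ⟨X, hX, -⟩ := hB.exists_path hσ
  exact ⟨X, hX⟩

/-- Near a given path there is another one: it follows the path to a high branching node and takes
the other child there. -/
theorem perfect_pathsOf : Perfect (pathsOf B) := by
  refine ⟨isClosed_pathsOf B, fun X hX => accPt_iff_nhds.2 fun U hU => ?_⟩
  rw [nhds_pi, Filter.mem_pi] at hU
  obtain ⟨I, hI, t, ht, hU⟩ := hU
  obtain ⟨N, hN⟩ := hI.bddAbove
  -- Strings of level N+1 have length at least N+1, so they fix every coordinate in `I`.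
  obtain ⟨σ, hσ, hXσ⟩ := hX (N + 1)
  obtain ⟨τ, hτ, hp⟩ := hB.exists_succ_of_mem hσ (!X σ.length)
  obtain ⟨Y, hY, hYτ⟩ := hB.exists_path hτ
  have hYσ := stringNhd_anti hp hYτ
  have hlen : N + 1 ≤ σ.length := by
    rw [hB.length_of_mem hσ]
    exact hB.strictMono_levelLength.le_apply
  refine ⟨Y, ⟨hU fun k hk => ?_, hY⟩, fun h => ?_⟩
  · have hk' : k < σ.length := lt_of_lt_of_le (Nat.lt_succ_of_le (hN hk)) hlen
    have h1 := stringNhd_anti (List.prefix_append _ _) hYσ k hk'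
    rw [h1, ← hXσ k hk']
    exact mem_of_mem_nhds (ht k)
  · have := hYσ σ.length (by simp)
    rw [h] at this
    simp at this

theorem exists_level {e k : ℕ} (h : levelLength B e < k) :
    ∃ j, e ≤ j ∧ levelLength B j < k ∧ k ≤ levelLength B (j + 1) := by
  classical
  have hex : ∃ j, k ≤ levelLength B j := ⟨k, hB.strictMono_levelLength.le_apply⟩
  have hfind := Nat.find_spec hex
  have he : e < Nat.find hex := by
    by_contra hle
    have := hB.strictMono_levelLength.monotone (not_lt.1 hle)
    omega
  obtain ⟨j, hj⟩ := Nat.exists_eq_succ_of_ne_zero (Nat.ne_of_gt (Nat.zero_lt_of_lt he))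
  refine ⟨j, by omega, ?_, by rw [hj] at hfind; exact hfind⟩
  have := Nat.find_min hex (m := j) (by omega)
  omega

/-- A string longer than level j separates the entries of level j+1, and being no longer than these
it is a prefix of the one that a path in its cone passes through. Hence both cones contain the same
paths. -/
theorem exists_entry {j k : ℕ} (h1 : levelLength B j < k) (h2 : k ≤ levelLength B (j + 1))
    {τ : List Bool} (hτ : τ.length = k) (hne : (pathsOf B ∩ stringNhd τ).Nonempty) :
    ∃ i < (B (j + 1)).length, τ = ((B (j + 1)).getD i []).take k ∧
      pathsOf B ∩ stringNhd τ = pathsOf B ∩ stringNhd ((B (j + 1)).getD i []) := by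
  obtain ⟨X, hX, hXτ⟩ := hne
  have hpre {Y : ℕ → Bool} {σ : List Bool} (hσ : σ ∈ B (j + 1)) (hY : Y ∈ stringNhd σ)
      (hYτ : Y ∈ stringNhd τ) : τ <+: σ := by
    rw [← mem_stringNhd_iff_initSeg.1 hYτ]
    exact initSeg_prefix_of_mem hY (by rw [hB.length_of_mem hσ, hτ]; exact h2)
  obtain ⟨σ, hσ, hXσ⟩ := hX (j + 1)
  have hτσ := hpre hσ hXσ hXτ
  obtain ⟨i, hi, hiσ⟩ := List.getElem_of_mem hσ
  refine ⟨i, hi, ?_, ?_⟩ <;> rw [List.getD_eq_getElem _ _ hi, hiσ]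
  · rw [← hτ]
    exact List.prefix_iff_eq_take.1 hτσ
  · refine Set.Subset.antisymm ?_ (Set.inter_subset_inter_right _ (stringNhd_anti hτσ))
    rintro Y ⟨hY, hYτ⟩
    obtain ⟨ρ, hρ, hYρ⟩ := hY (j + 1)
    have hτρ := hpre hρ hYρ hYτ
    have htake {ρ : List Bool} (h : τ <+: ρ) :
        ρ.take (levelLength B j + 1) = τ.take (levelLength B j + 1) := by
      rw [List.prefix_iff_eq_take.1 h, List.take_take, min_eq_left (by omega)]
    have : σ = ρ := hB.eq_of_take_eq hσ hρ ((htake hτσ).trans (htake hτρ).symm)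
    exact ⟨hY, this ▸ hYρ⟩

end IsTreeSequence

/-! ## Verification of the construction -/

/-- The product of the neighbourhoods given by `l` is disjoint from `piClass e`. -/
def Forced (e : ℕ) (l : List (List Bool)) : Prop :=
  ∀ Xs : List (ℕ → Bool), List.Forall₂ (fun X σ => X ∈ stringNhd σ) Xs l →
    toBaire (joinSeqs Xs) ∉ piClass e

theorem forced_of_haltsOn {e : ℕ} {l : List (List Bool)}
    (h : HaltsOn e ((joinStrings l).map Bool.toNat)) : Forced e l := by
  intro Xs hXs hmem
  refine hmem (oraclePhi_dom_of_haltsOn h fun k y hk => ?_)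
  rw [List.getElem?_map, Option.map_eq_some_iff] at hk
  obtain ⟨b, hb, rfl⟩ := hk
  rw [toBaire, mem_stringNhd_iff.1 (joinSeqs_mem_stringNhd hXs) k b hb]

/-- Extending strings shrinks the product, so a pair once settled remains settled when its level is
replaced again. -/
theorem Forced.mono {e : ℕ} {I : List ℕ} {A A' : List (List Bool)} (h : Extends A A')
    (hf : Forced e (selectEntries A I)) : Forced e (selectEntries A' I) := by
  intro Xs hXs
  refine hf Xs ?_
  rw [selectEntries, List.forall₂_map_right_iff] at hXs ⊢
  exact hXs.imp fun X i hX => stringNhd_anti (h.getD_prefix i) hX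

/-- The pairs that may be settled at level `j`. -/
def settleable (j : ℕ) : Set (ℕ × List ℕ) :=
  {q | q.1 ≤ j ∧ q.2.length ≤ 2 ^ j ∧ ∀ i ∈ q.2, i < 2 ^ j}

/-- This finiteness bounds how often a level changes after the lower levels have stabilized. -/
theorem finite_settleable (j : ℕ) : (settleable j).Finite := by
  refine ((Set.finite_Iic j).prod ((List.finite_length_le (Fin (2 ^ j)) (2 ^ j)).image
    (List.map Fin.val))).subset ?_
  rintro ⟨e, I⟩ ⟨he, hlen, hlt⟩
  refine ⟨he, I.pmap Fin.mk hlt, by simpa using hlen, ?_⟩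
  simp [List.map_pmap]

namespace TreeStage

/-! ### Truncating a stage and replacing a level -/

theorem getD_eq_of_take_eq {S T : TreeStage} {n j : ℕ} (h : S.take n = T.take n) (hj : j < n) :
    S.getD j ([], []) = T.getD j ([], []) := by
  rw [List.getD_eq_getElem?_getD, List.getD_eq_getElem?_getD, ← List.getElem?_take_of_lt hj, h,
    List.getElem?_take_of_lt hj]

theorem strings_eq_of_take_eq {S T : TreeStage} {n j : ℕ} (h : S.take n = T.take n) (hj : j < n) :
    S.strings j = T.strings j := by
  rw [strings, getD_eq_of_take_eq h hj, strings]

theorem settled_eq_of_take_eq {S T : TreeStage} {n j : ℕ} (h : S.take n = T.take n) (hj : j < n) :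
    S.settled j = T.settled j := by
  rw [settled, getD_eq_of_take_eq h hj, settled]

section Replace

variable {S : TreeStage} {n : ℕ} (hn : n ≤ S.length) (x : List (List Bool) × List (ℕ × List ℕ))

include hn

theorem length_replace : (S.take n ++ [x]).length = n + 1 := by
  simp [hn]

theorem take_replace {m : ℕ} (hm : m ≤ n) : (S.take n ++ [x]).take m = S.take m := by
  rw [List.take_append_of_le_length (by simp; omega), List.take_take, min_eq_left hm]

theorem getD_replace : (S.take n ++ [x]).getD n ([], []) = x := by
  simp [List.getD_eq_getElem?_getD, hn]

theorem top_replace : TreeStage.top (S.take n ++ [x]) = x.1 := by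
  rw [top, length_replace hn, Nat.add_sub_cancel, strings, getD_replace hn]

end Replace

theorem pick_spec {S : TreeStage} {σ : List Bool} (h : ∃ τ ∈ S.top, σ <+: τ) :
    S.pick σ ∈ S.top ∧ σ <+: S.pick σ := by
  have hex : S.top.findIdx (fun τ => decide (σ <+: τ)) < S.top.length :=
    List.findIdx_lt_length_of_exists (by simpa using h)
  rw [pick, List.getD_eq_getElem _ _ hex]
  exact ⟨List.getElem_mem _, by simpa using List.findIdx_getElem (w := hex)⟩

theorem grow_eq (S : TreeStage) : S.grow = S.take S.length ++ [(children S.top, [])] := by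
  rw [grow, List.take_length]

theorem step_eq_or (S : TreeStage) (c : Option Candidate) :
    S.step c = S.grow ∨ ∃ c', c = some c' ∧ S.Eligible c' ∧ S.step c = S.act c' := by
  cases c with
  | none => exact Or.inl rfl
  | some c =>
    by_cases h : S.Eligible c
    · exact Or.inr ⟨c, rfl, h, by simp [step, h]⟩
    · exact Or.inl (by simp [step, h])

/-- The strings of a level all have the same length, and its settled pairs are settled for a
reason. -/
structure ValidLevel (j : ℕ) (x : List (List Bool) × List (ℕ × List ℕ)) : Prop where
  uniform : ∃ n, ∀ σ ∈ x.1, σ.length = n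
  nodup : x.2.Nodup
  mem_settleable : ∀ q ∈ x.2, q ∈ settleable j
  forced : ∀ q ∈ x.2, Forced q.1 (selectEntries x.1 q.2)

/-- The properties of stages that are preserved by the construction. -/
structure Valid (S : TreeStage) : Prop where
  pos : 0 < S.length
  zero : Extends [[]] (S.strings 0)
  level : ∀ j < S.length, ValidLevel j (S.getD j ([], []))
  succ : ∀ j, j + 1 < S.length → Extends (children (S.strings j)) (S.strings (j + 1))

/-! ### Preservation of the invariants -/

namespace Valid

variable {S : TreeStage} (hS : S.Valid)

include hS

/-- Growing and acting both keep the first n levels and append one, so the invariants need to be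
checked only for the new level. -/
theorem replace {n : ℕ} (hn : n ≤ S.length) {x : List (List Bool) × List (ℕ × List ℕ)}
    (hx : ValidLevel n x) (h0 : n = 0 → Extends [[]] x.1)
    (hsucc : ∀ j, n = j + 1 → Extends (children (S.strings j)) x.1) :
    Valid (S.take n ++ [x]) := by
  have hlow : ∀ j < n, (S.take n ++ [x]).getD j ([], []) = S.getD j ([], []) := fun j hj =>
    getD_eq_of_take_eq (take_replace hn x le_rfl) hj
  have hlow' : ∀ j < n, TreeStage.strings (S.take n ++ [x]) j = S.strings j := fun j hj =>
    strings_eq_of_take_eq (take_replace hn x le_rfl) hj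
  have htop : TreeStage.strings (S.take n ++ [x]) n = x.1 := by rw [strings, getD_replace hn]
  refine ⟨by rw [length_replace hn]; omega, ?_, fun j hj => ?_, fun j hj => ?_⟩
  · rcases Nat.eq_zero_or_pos n with rfl | h
    · rw [htop]
      exact h0 rfl
    · rw [hlow' 0 h]
      exact hS.zero
  · rw [length_replace hn] at hj
    rcases Nat.lt_succ_iff_lt_or_eq.1 hj with h | rfl
    · rw [hlow j h]
      exact hS.level j (h.trans_le hn)
    · rw [getD_replace hn]
      exact hx
  · rw [length_replace hn] at hj
    rcases Nat.lt_succ_iff_lt_or_eq.1 hj with h | rfl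
    · rw [hlow' _ h, hlow' _ (by omega)]
      exact hS.succ j (by omega)
    · rw [htop, hlow' j (by omega)]
      exact hsucc j rfl

theorem top_uniform : ∃ n, ∀ σ ∈ S.top, σ.length = n :=
  (hS.level (S.length - 1) (Nat.sub_lt hS.pos one_pos)).uniform

theorem length_strings {j : ℕ} (hj : j < S.length) : (S.strings j).length = 2 ^ j := by
  induction j with
  | zero => simpa using hS.zero.length_eq.symm
  | succ j ih => rw [← (hS.succ j hj).length_eq, length_children, ih (by omega), pow_succ']

theorem grow : S.grow.Valid := by
  rw [grow_eq]
  refine hS.replace le_rfl ⟨?_, List.nodup_nil, by simp, by simp⟩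
    (fun h => absurd h hS.pos.ne') fun j hj => ?_
  · obtain ⟨n, hn⟩ := hS.top_uniform
    refine ⟨n + 1, fun σ hσ => ?_⟩
    obtain ⟨τ, hτ, b, rfl⟩ := mem_children.1 hσ
    simp [hn τ hτ]
  · rw [top, hj, Nat.add_sub_cancel]
    exact Extends.refl _

theorem act {c : Candidate} (hc : S.Eligible c)
    (hh : HaltsOn c.2.2.1 ((joinStrings (selectEntries c.2.1 c.2.2.2)).map Bool.toNat)) :
    (S.act c).Valid := by
  obtain ⟨hlt, he, hlen, hI, hnot, htop, hlen', hpre⟩ := hc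
  have hext : Extends (S.strings c.1) (c.2.1.map S.pick) :=
    Extends.of_getD_prefix (by simpa using hlen') (by simpa using hpre)
  have hpick : Extends c.2.1 (c.2.1.map S.pick) := by
    rw [Extends, List.forall₂_map_right_iff, List.forall₂_same]
    exact fun σ hσ => (pick_spec (htop σ hσ)).2
  have hlevel := hS.level c.1 hlt
  refine hS.replace hlt.le ⟨?_, ?_, ?_, ?_⟩ (fun h => ?_) fun j hj => ?_
  -- The new strings are all chosen from the last level, so they have one common length.
  · obtain ⟨n, hn⟩ := hS.top_uniform
    refine ⟨n, fun σ hσ => ?_⟩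
    obtain ⟨τ, hτ, rfl⟩ := List.mem_map.1 hσ
    exact hn _ (pick_spec (htop τ hτ)).1
  · exact List.nodup_cons.2 ⟨hnot, hlevel.nodup⟩
  · intro q hq
    rcases List.mem_cons.1 hq with rfl | hq
    · rw [hS.length_strings hlt] at hlen hI
      exact ⟨he, hlen, hI⟩
    · exact hlevel.mem_settleable q hq
  · intro q hq
    rcases List.mem_cons.1 hq with rfl | hq
    -- The computation uses the strings of the candidate, and the chosen strings extend these.
    · exact (forced_of_haltsOn hh).mono hpick
    · exact (hlevel.forced q hq).mono hext
  · rw [h] at hext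
    exact hS.zero.trans hext
  · rw [hj] at hext hlt
    exact (hS.succ j hlt).trans hext

theorem step {c : Option Candidate} (hc : ∀ c', c = some c' →
    HaltsOn c'.2.2.1 ((joinStrings (selectEntries c'.2.1 c'.2.2.2)).map Bool.toNat)) :
    (S.step c).Valid := by
  rcases S.step_eq_or c with h | ⟨c', hc', he, h⟩ <;> rw [h]
  · exact hS.grow
  · exact hS.act he (hc c' hc')

theorem coverOf_antitone {i j : ℕ} (hij : i ≤ j) (hj : j < S.length) :
    coverOf (S.strings j) ⊆ coverOf (S.strings i) := by
  induction j, hij using Nat.le_induction with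
  | base => exact subset_rfl
  | succ j _ ih =>
    refine (coverOf_anti fun τ hτ => ?_).trans (ih (by omega))
    obtain ⟨ρ, hρ, hp⟩ := (hS.succ j hj).exists_left hτ
    obtain ⟨σ, hσ, b, rfl⟩ := mem_children.1 hρ
    exact ⟨σ, hσ, (List.prefix_append _ _).trans hp⟩

theorem le_length {j : ℕ} (hj : j < S.length) {σ : List Bool} (hσ : σ ∈ S.strings j) :
    j ≤ σ.length := by
  induction j generalizing σ with
  | zero => exact Nat.zero_le _
  | succ j ih =>
    obtain ⟨ρ, hρ, hp⟩ := (hS.succ j hj).exists_left hσ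
    obtain ⟨τ, hτ, b, rfl⟩ := mem_children.1 hρ
    have h1 := ih (by omega) hτ
    have h2 := hp.length_le
    simp at h2
    omega

end Valid

/-- Passing to children does not change the covered set, and acting keeps only strings of the old
last level. -/
theorem coverOf_top_step_subset (S : TreeStage) (c : Option Candidate) :
    coverOf (S.step c).top ⊆ coverOf S.top := by
  rcases S.step_eq_or c with h | ⟨c', -, he, h⟩ <;> rw [h]
  · rw [grow_eq, top_replace le_rfl, coverOf_children]
  · rw [act, top_replace he.1.le]
    refine coverOf_anti fun τ hτ => ?_
    obtain ⟨σ, hσ, rfl⟩ := List.mem_map.1 hτ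
    exact ⟨_, (pick_spec (he.2.2.2.2.2.1 σ hσ)).1, List.prefix_refl _⟩

end TreeStage

/-! ## Stabilization of the levels -/

/-- Every candidate carries a halting computation. -/
def Sound (f : ℕ → Option Candidate) : Prop := ∀ s c, f s = some c →
  HaltsOn c.2.2.1 ((joinStrings (selectEntries c.2.1 c.2.2.2)).map Bool.toNat)

namespace TreeStage

variable {f : ℕ → Option Candidate}

theorem valid_stage (hf : Sound f) (s : ℕ) : (stage f s).Valid := by
  induction s with
  | zero =>
    refine ⟨by simp [stage], by simp [stage, strings], fun j hj => ?_, fun j hj => ?_⟩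
    · obtain rfl : j = 0 := by simpa [stage] using hj
      exact ⟨⟨0, by simp [stage]⟩, by simp [stage], by simp [stage], by simp [stage]⟩
    · simp [stage] at hj
  | succ s ih => exact ih.step (hf s)

theorem antitone_coverOf_top (f : ℕ → Option Candidate) :
    Antitone fun s => coverOf (stage f s).top :=
  antitone_nat_of_succ_le fun s => coverOf_top_step_subset (stage f s) (f s)

/-- The first `j` levels exist at stage `s`, and they do not change after stage `s`. -/
def IsStable (f : ℕ → Option Candidate) (j s : ℕ) : Prop :=
  ∀ t, s ≤ t → j ≤ (stage f t).length ∧ (stage f t).take j = (stage f s).take j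

theorem IsStable.mono {i j s t : ℕ} (h : IsStable f j s) (hij : i ≤ j) (hst : s ≤ t) :
    IsStable f i t := by
  intro u hu
  obtain ⟨h1, h2⟩ := h u (hst.trans hu)
  refine ⟨hij.trans h1, ?_⟩
  rw [← min_eq_left hij, ← List.take_take, ← List.take_take, h2, (h t hst).2]

theorem take_grow {S : TreeStage} {j : ℕ} (hj : j ≤ S.length) : S.grow.take j = S.take j := by
  rw [grow_eq, take_replace le_rfl _ hj]

theorem take_act {S : TreeStage} {c : Candidate} (hc : S.Eligible c) {j : ℕ} (hj : j ≤ c.1) :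
    (S.act c).take j = S.take j := take_replace hc.1.le _ hj

theorem length_act {S : TreeStage} {c : Candidate} (hc : S.Eligible c) :
    (S.act c).length = c.1 + 1 := length_replace hc.1.le _

theorem settled_act {S : TreeStage} {c : Candidate} (hc : S.Eligible c) :
    (S.act c).settled c.1 = c.2.2 :: S.settled c.1 := by
  rw [settled, act, getD_replace hc.1.le]

/-- Acting lengthens the list of settled pairs at its level, so that level was not yet stable. -/
theorem IsStable.le_of_act {j s : ℕ} (h : IsStable f j s) {t : ℕ} (ht : s ≤ t) {c : Candidate}
    (hc : (stage f t).Eligible c) (hact : stage f (t + 1) = (stage f t).act c) : j ≤ c.1 := by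
  by_contra hlt
  have heq := settled_eq_of_take_eq ((h (t + 1) (by omega)).2.trans (h t ht).2.symm) (not_le.1 hlt)
  rw [hact, settled_act hc] at heq
  simpa using congrArg List.length heq

theorem IsStable.succ_cases {j s : ℕ} (h : IsStable f j s) {t : ℕ} (ht : s ≤ t) :
    j < (stage f (t + 1)).length ∧ (j < (stage f t).length →
      (stage f (t + 1)).take (j + 1) = (stage f t).take (j + 1) ∨
      ((stage f (t + 1)).settled j).length = ((stage f t).settled j).length + 1) := by
  rcases (stage f t).step_eq_or (f t) with hgrow | ⟨c, -, hc, hact⟩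
  · have hgrow' : stage f (t + 1) = (stage f t).grow := hgrow
    refine ⟨?_, fun hj => Or.inl ?_⟩
    · rw [hgrow', grow_eq, length_replace le_rfl]
      exact Nat.lt_succ_of_le (h t ht).1
    · rw [hgrow', take_grow hj]
  · have hact' : stage f (t + 1) = (stage f t).act c := hact
    have hle := h.le_of_act ht hc hact'
    refine ⟨by rw [hact', length_act hc]; omega, fun hj => ?_⟩
    rcases hle.eq_or_lt with rfl | hlt
    · right
      rw [hact', settled_act hc, List.length_cons]
    · left
      rw [hact', take_act hc hlt]

theorem Valid.length_settled_le {S : TreeStage} (hS : S.Valid) {j : ℕ} (hj : j < S.length) :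
    (S.settled j).length ≤ (finite_settleable j).toFinset.card := by
  classical
  have h := hS.level j hj
  rw [settled, ← List.toFinset_card_of_nodup h.nodup]
  refine Finset.card_le_card fun q hq => ?_
  rw [Set.Finite.mem_toFinset]
  exact h.mem_settleable q (List.mem_toFinset.1 hq)

/-- Over stable lower levels, each change of level j adds a settled pair, and their number is
bounded. A stage where this number is maximal is therefore stable. Only stages after s are
considered, since level j need not exist at s. -/
theorem IsStable.exists_succ (hf : Sound f) {j s : ℕ} (h : IsStable f j s) :
    ∃ t, IsStable f (j + 1) t := by
  have hlen (t : ℕ) (ht : s < t) : j < (stage f t).length := by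
    obtain ⟨u, rfl⟩ := Nat.exists_eq_succ_of_ne_zero (Nat.ne_of_gt (Nat.zero_lt_of_lt ht))
    exact (h.succ_cases (Nat.lt_succ_iff.1 ht)).1
  let N : ℕ → ℕ := fun t => ((stage f t).settled j).length
  have hcases (t : ℕ) (ht : s < t) :
      (stage f (t + 1)).take (j + 1) = (stage f t).take (j + 1) ∨ N (t + 1) = N t + 1 :=
    (h.succ_cases ht.le).2 (hlen t ht)
  have hstep (t : ℕ) (ht : s < t) : N t ≤ N (t + 1) := by
    rcases hcases t ht with h | h
    · simp only [N, settled_eq_of_take_eq h (Nat.lt_succ_self j), le_refl]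
    · omega
  have hmono (t u : ℕ) (ht : s < t) (hu : t ≤ u) : N t ≤ N u := by
    induction u, hu using Nat.le_induction with
    | base => exact le_rfl
    | succ u hu ih => exact ih.trans (hstep u (ht.trans_le hu))
  have hbdd : BddAbove (N '' {t | s < t}) := by
    refine ⟨(finite_settleable j).toFinset.card, ?_⟩
    rintro _ ⟨t, ht, rfl⟩
    exact (valid_stage hf t).length_settled_le (hlen t ht)
  obtain ⟨t, ht, htmax⟩ := Nat.sSup_mem (Set.Nonempty.image N ⟨s + 1, Nat.lt_succ_self s⟩) hbdd
  have ht' : s < t := ht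
  refine ⟨t, fun u hu => ⟨hlen u (ht'.trans_le hu), ?_⟩⟩
  induction u, hu using Nat.le_induction with
  | base => rfl
  | succ u hu ih =>
    rcases hcases u (ht'.trans_le hu) with h | h
    · exact h.trans ih
    · have h1 : N (u + 1) ≤ N t := by
        rw [htmax]
        exact le_csSup hbdd ⟨u + 1, ht'.trans_le (by omega), rfl⟩
      have h2 := hmono t u ht' hu
      omega

theorem exists_isStable (hf : Sound f) (j : ℕ) : ∃ s, IsStable f j s := by
  induction j with
  | zero => exact ⟨0, fun t _ => by simp⟩
  | succ j ih =>
    obtain ⟨s, hs⟩ := ih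
    exact hs.exists_succ hf

/-- `B` and `C` are the limits of the strings and of the settled pairs of the levels. -/
def IsLimit (f : ℕ → Option Candidate) (B : ℕ → List (List Bool)) (C : ℕ → List (ℕ × List ℕ)) :
    Prop :=
  ∀ j s, IsStable f (j + 1) s → (stage f s).strings j = B j ∧ (stage f s).settled j = C j

theorem exists_isLimit (hf : Sound f) : ∃ B C, IsLimit f B C := by
  choose σ hσ using fun j => exists_isStable hf (j + 1)
  refine ⟨fun j => (stage f (σ j)).strings j, fun j => (stage f (σ j)).settled j,
    fun j s hs => ?_⟩
  have h : (stage f s).take (j + 1) = (stage f (σ j)).take (j + 1) := by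
    rw [← (hs (max s (σ j)) (le_max_left _ _)).2, (hσ j (max s (σ j)) (le_max_right _ _)).2]
  exact ⟨strings_eq_of_take_eq h (Nat.lt_succ_self j), settled_eq_of_take_eq h (Nat.lt_succ_self j)⟩

/-! ### The limit tree -/

namespace IsLimit

variable {B : ℕ → List (List Bool)} {C : ℕ → List (ℕ × List ℕ)} (hf : Sound f)
  (hB : IsLimit f B C)

include hf hB

theorem isTreeSequence : IsTreeSequence B := by
  refine ⟨?_, fun j => ?_, fun j => ?_⟩
  · obtain ⟨s, hs⟩ := exists_isStable hf 1
    rw [← (hB 0 s hs).1]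
    exact (valid_stage hf s).zero
  · obtain ⟨s, hs⟩ := exists_isStable hf (j + 1 + 1)
    rw [← (hB (j + 1) s hs).1, ← (hB j s (hs.mono (Nat.le_succ _) le_rfl)).1]
    exact (valid_stage hf s).succ j (hs s le_rfl).1
  · obtain ⟨s, hs⟩ := exists_isStable hf (j + 1)
    rw [← (hB j s hs).1]
    exact ((valid_stage hf s).level j (hs s le_rfl).1).uniform

theorem forced {j : ℕ} {q : ℕ × List ℕ} (hq : q ∈ C j) : Forced q.1 (selectEntries (B j) q.2) := by
  obtain ⟨s, hs⟩ := exists_isStable hf (j + 1)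
  rw [← (hB j s hs).1]
  rw [← (hB j s hs).2] at hq
  exact ((valid_stage hf s).level j (hs s le_rfl).1).forced q hq

/-- Let j be the number of levels at stage s. When the first j+1 levels become stable, the last step
has just created or replaced one of them, so no later level exists: the last level at that moment is
the final level j. The covers decrease with the stage. -/
theorem coverOf_top_subset (s : ℕ) : ∃ j, coverOf (B j) ⊆ coverOf (stage f s).top := by
  classical
  set j := (stage f s).length with hj
  have hex := exists_isStable hf (j + 1)
  have hspec := Nat.find_spec hex
  have hlt : s < Nat.find hex := by
    by_contra hle
    have := (hspec s (not_lt.1 hle)).1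
    omega
  obtain ⟨u, hu⟩ := Nat.exists_eq_succ_of_ne_zero (Nat.ne_of_gt (Nat.zero_lt_of_lt hlt))
  have hnot : ¬ IsStable f (j + 1) u := Nat.find_min hex (by omega)
  rw [hu] at hspec
  have hchange : ¬ (j + 1 ≤ (stage f u).length ∧
      (stage f (u + 1)).take (j + 1) = (stage f u).take (j + 1)) := by
    rintro ⟨h1, h2⟩
    refine hnot fun t ht => ?_
    rcases ht.eq_or_lt with rfl | ht
    · exact ⟨h1, rfl⟩
    · exact ⟨(hspec t ht).1, (hspec t ht).2.trans h2⟩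
  have hlen : (stage f (u + 1)).length = j + 1 := by
    refine le_antisymm ?_ (hspec _ le_rfl).1
    rcases (stage f u).step_eq_or (f u) with hgrow | ⟨c, -, hc, hact⟩
    · have hgrow' : stage f (u + 1) = (stage f u).grow := hgrow
      rw [hgrow', grow_eq, length_replace le_rfl]
      by_contra hle
      exact hchange ⟨by omega, by rw [hgrow', take_grow (by omega)]⟩
    · have hact' : stage f (u + 1) = (stage f u).act c := hact
      rw [hact', length_act hc]
      by_contra hle
      exact hchange ⟨by have := hc.1; omega, by rw [hact', take_act hc (by omega)]⟩
  refine ⟨j, ?_⟩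
  rw [← (hB j _ hspec).1]
  have : (stage f (u + 1)).strings j = (stage f (u + 1)).top := by
    rw [top, hlen, Nat.add_sub_cancel]
  have hle : s ≤ u + 1 := by omega
  exact this ▸ antitone_coverOf_top f hle

theorem pathsOf_eq : pathsOf B = {X | ∀ s, X ∈ coverOf (stage f s).top} := by
  refine Set.Subset.antisymm (fun X hX s => ?_) fun X hX j => ?_
  · obtain ⟨j, hj⟩ := hB.coverOf_top_subset hf s
    exact hj (hX j)
  · obtain ⟨s, hs⟩ := exists_isStable hf (j + 1)
    rw [← (hB j s hs).1]
    have hlen : j < (stage f s).length := (hs s le_rfl).1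
    exact (valid_stage hf s).coverOf_antitone (by omega) (by omega) (hX s)

/-- Otherwise a computation halts on initial segments of the `X t`. Its candidate is enumerated
again after level j has stabilized and is then eligible, so the construction would change a stable
level. -/
theorem mem_piClass_of_notMem
    (hcomplete : ∀ c : Candidate,
      HaltsOn c.2.2.1 ((joinStrings (selectEntries c.2.1 c.2.2.2)).map Bool.toNat) →
        ∀ s₀, ∃ s, s₀ ≤ s ∧ f s = some c)
    {e j n : ℕ} (he : e ≤ j) (hn : n ≠ 0) {i : Fin n → ℕ} (hi : Function.Injective i)
    (hlt : ∀ t, i t < 2 ^ j) (hnot : (e, List.ofFn i) ∉ C j) {X : Fin n → ℕ → Bool}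
    (hX : ∀ t, X t ∈ pathsOf B ∩ stringNhd ((B j).getD (i t) [])) :
    toBaire (joinSeqs (List.ofFn X)) ∈ piClass e := by
  classical
  have hT := hB.isTreeSequence hf
  intro hdom
  obtain ⟨k, hk⟩ := exists_haltsOn_initSeg hdom
  -- A candidate replaces the whole level, so entries not selected by `i` get arbitrary paths.
  -- Injectivity of `i` prevents conflicting choices.
  have hY : ∃ Y : ℕ → ℕ → Bool, (∀ t, Y (i t) = X t) ∧
      ∀ a < 2 ^ j, Y a ∈ pathsOf B ∧ Y a ∈ stringNhd ((B j).getD a []) := by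
    have hpath (a : ℕ) (ha : a < 2 ^ j) :
        ∃ Z, Z ∈ pathsOf B ∧ Z ∈ stringNhd ((B j).getD a []) := by
      rw [← hT.length_eq j] at ha
      rw [List.getD_eq_getElem _ _ ha]
      exact hT.exists_path (List.getElem_mem ha)
    choose! Z hZ using hpath
    refine ⟨fun a => if h : ∃ t, i t = a then X h.choose else Z a, fun t => ?_, fun a ha => ?_⟩
    · have h : ∃ t', i t' = i t := ⟨t, rfl⟩
      exact (dif_pos h).trans (congrArg X (hi h.choose_spec))
    · beta_reduce
      by_cases h : ∃ t, i t = a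
      · rw [dif_pos h]
        have := hX h.choose
        rwa [h.choose_spec] at this
      · rw [dif_neg h]
        exact hZ a ha
  obtain ⟨Y, hYX, hY⟩ := hY
  -- Length k suffices for halting; length `levelLength B j` makes the segments extend the strings
  -- of level j.
  set L := max k (levelLength B j) with hL
  let A' := (List.range (2 ^ j)).map fun a => initSeg (Y a) L
  have hA' (a : ℕ) (ha : a < 2 ^ j) : A'.getD a [] = initSeg (Y a) L := by
    rw [List.getD_eq_getElem _ _ (by simpa [A'] using ha)]
    simp [A']
  have hselect : selectEntries A' (List.ofFn i) = (List.ofFn X).map fun X => initSeg X L := by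
    simp only [selectEntries, List.map_ofFn]
    congr 1
    funext t
    rw [Function.comp_apply, hA' _ (hlt t), hYX, Function.comp_apply]
  have hhalt : HaltsOn e ((joinStrings (selectEntries A' (List.ofFn i))).map Bool.toNat) := by
    have hne : List.ofFn X ≠ [] := by simpa using hn
    obtain ⟨l, hl, hjoin⟩ := exists_joinStrings_initSeg hne L
    rw [hselect, hjoin, initSeg, List.map_map]
    exact hk l ((le_max_left _ _).trans hl)
  -- With more than L levels, the strings of the last level have length at least L, so those along
  -- the paths extend the segments.
  obtain ⟨s₀, hs₀⟩ := exists_isStable hf (max (j + 1) (L + 1))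
  obtain ⟨s, hs, hfs⟩ := hcomplete (j, A', e, List.ofFn i) hhalt s₀
  have hstable : IsStable f (j + 1) s := hs₀.mono (le_max_left _ _) hs
  have hlen : L < (stage f s).length := (le_max_right (j + 1) (L + 1)).trans (hs₀ s hs).1
  have hval := valid_stage hf s
  have htop (a : ℕ) (ha : a < 2 ^ j) : ∃ τ ∈ (stage f s).top, initSeg (Y a) L <+: τ := by
    have hmem := (hY a ha).1
    rw [hB.pathsOf_eq hf] at hmem
    obtain ⟨τ, hτ, hYτ⟩ := hmem s
    have hpos := hval.pos
    have hle : (stage f s).length - 1 ≤ τ.length := hval.le_length (by omega) hτ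
    exact ⟨τ, hτ, initSeg_prefix_of_mem hYτ (by omega)⟩
  have hstr := (hB j s hstable).1
  have hjlen : j < (stage f s).length := (hstable s le_rfl).1
  have hcard := hval.length_strings hjlen
  have helig : (stage f s).Eligible (j, A', e, List.ofFn i) := by
    refine ⟨hjlen, he, ?_, ?_, ?_, ?_, ?_, ?_⟩
    · simp only [hcard, List.length_ofFn]
      have := Fintype.card_le_of_injective (fun t => (⟨i t, hlt t⟩ : Fin (2 ^ j)))
        fun t t' h => hi (Fin.mk.inj h)
      simpa using this
    · intro a ha
      obtain ⟨t, rfl⟩ := (List.mem_ofFn' _ _).1 ha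
      rw [hcard]
      exact hlt t
    · simp only [(hB j s hstable).2]
      exact hnot
    · intro σ hσ
      obtain ⟨a, ha, rfl⟩ := List.mem_map.1 hσ
      exact htop a (List.mem_range.1 ha)
    · simp [hcard, A']
    · intro a ha
      have ha' : a < 2 ^ j := by simpa [A'] using ha
      have hpick := (pick_spec (htop a ha')).2
      have : (A'.map (stage f s).pick).getD a [] = (stage f s).pick (initSeg (Y a) L) := by
        rw [List.getD_eq_getElem _ _ (by simpa using ha)]
        simp [A']
      simp only [this, hstr]
      refine (prefix_initSeg_of_mem (hY a ha').2 ?_).trans hpick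
      have hlt' : a < (B j).length := by rwa [hT.length_eq]
      rw [List.getD_eq_getElem _ _ hlt', hT.length_of_mem (List.getElem_mem hlt')]
      exact le_max_right _ _
  have hact : stage f (s + 1) = (stage f s).act (j, A', e, List.ofFn i) := by
    simp [stage, step, hfs, helig]
  have := hstable.le_of_act le_rfl helig hact
  simp at this

end IsLimit

end TreeStage

/-! ## The main theorem -/

/-- `σ` is compatible with one of the strings in `A`. -/
def CompatibleWith (σ : List ℕ) (A : List (List Bool)) : Prop :=
  ∃ τ ∈ A, σ.take τ.length = (τ.map Bool.toNat).take σ.length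

open Primrec in
theorem primrecRel_compatibleWith : PrimrecRel CompatibleWith := by
  have hmap : Primrec fun p : List Bool × List ℕ => p.1.map Bool.toNat :=
    list_map fst ((dom_finite Bool.toNat).comp snd)
  have h : PrimrecRel fun (A : List (List Bool)) (σ : List ℕ) =>
      ∃ τ ∈ A, σ.take τ.length = (τ.map Bool.toNat).take σ.length :=
    PrimrecRel.exists_mem_list (Primrec.eq.comp
      (list_take.comp (list_length.comp fst) snd) (list_take.comp (list_length.comp snd) hmap))
  exact h.comp snd fst

theorem initSeg_toBaire (X : ℕ → Bool) (k : ℕ) :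
    initSeg (toBaire X) k = (initSeg X k).map Bool.toNat := by
  rw [initSeg, initSeg, List.map_map]
  rfl

namespace TreeStage

variable {f : ℕ → Option Candidate}

/-- Members of the right side are not binary by assumption; compatibility with arbitrarily long
binary strings of last levels forces this. -/
theorem toBaire_image_eq (hf : Sound f) :
    toBaire '' {X | ∀ s, X ∈ coverOf (stage f s).top} =
      {X | ∀ s k, CompatibleWith (initSeg X k) (stage f s).top} := by
  refine Set.Subset.antisymm ?_ fun X hX => ?_
  · rintro _ ⟨X, hX, rfl⟩ s k
    obtain ⟨τ, hτ, hXτ⟩ := hX s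
    refine ⟨τ, hτ, ?_⟩
    rw [initSeg_toBaire, List.length_map, length_initSeg, ← List.map_take, ← List.map_take]
    congr 1
    conv_rhs => rw [← mem_stringNhd_iff_initSeg.1 hXτ]
    rcases le_total k τ.length with h | h
    · rw [initSeg_take X h, List.take_of_length_le (by simpa using h)]
    · rw [initSeg_take X h, List.take_of_length_le (by simpa using h)]
  · have key (s : ℕ) : ∃ τ ∈ (stage f s).top, initSeg X τ.length = τ.map Bool.toNat := by
      obtain ⟨n, hn⟩ := (valid_stage hf s).top_uniform
      obtain ⟨τ, hτ, h⟩ := hX s n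
      refine ⟨τ, hτ, ?_⟩
      rwa [hn τ hτ, length_initSeg, List.take_of_length_le (by simp),
        List.take_of_length_le (by simp [hn τ hτ]), ← hn τ hτ] at h
    have hget {τ : List Bool} (h : initSeg X τ.length = τ.map Bool.toNat) (k : ℕ)
        (hk : k < τ.length) : X k = (τ[k]).toNat := by
      have := congrArg (fun l => l[k]?) h
      simp only [getElem?_initSeg X hk, List.getElem?_map, List.getElem?_eq_getElem hk,
        Option.map_some, Option.some.injEq] at this
      exact this
    have hbin (k : ℕ) : ∃ b : Bool, X k = b.toNat := by
      -- With at least k+2 levels, the last one has index at least k+1, so its strings have a bit at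
      -- position k.
      obtain ⟨s, hs⟩ := exists_isStable hf (k + 2)
      obtain ⟨τ, hτ, h⟩ := key s
      have hlen := (hs s le_rfl).1
      have := (valid_stage hf s).le_length (j := (stage f s).length - 1) (by omega) hτ
      exact ⟨_, hget h k (by omega)⟩
    choose Z hZ using hbin
    have hZX : toBaire Z = X := funext fun k => (hZ k).symm
    refine ⟨Z, fun s => ?_, hZX⟩
    obtain ⟨τ, hτ, h⟩ := key s
    refine ⟨τ, hτ, mem_stringNhd_iff_initSeg.2 ?_⟩
    rw [← hZX, initSeg_toBaire] at h
    exact List.map_injective_iff.2 (fun a b => by cases a <;> cases b <;> simp) h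

theorem isPiClass_toBaire_image (hf : Sound f) (hcomp : Computable f) :
    IsPiClass (toBaire '' {X | ∀ s, X ∈ coverOf (stage f s).top}) := by
  classical
  have hD : Computable₂ fun (s : ℕ) (σ : List ℕ) =>
      decide (CompatibleWith σ (stage f s).top) :=
    primrecRel_compatibleWith.decide.to_comp.comp Computable.snd
      (primrec_top.to_comp.comp ((computable_stage hcomp).comp Computable.fst))
  have := isPiClass_of_computable hD
  rw [toBaire_image_eq hf]
  simpa using this

/-- The first `n` levels of `S` do not all exist, or they differ from those of `T`. -/
def LevelsDiffer (S : TreeStage) (p : ℕ × TreeStage) : Prop :=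
  S.length < p.1 ∨ ¬ S.take p.1 = p.2.take p.1

open Primrec in
theorem primrecRel_levelsDiffer : PrimrecRel LevelsDiffer := by
  have hn : Primrec fun q : TreeStage × ℕ × TreeStage => q.2.1 := fst.comp snd
  refine .or (nat_lt.comp (list_length.comp fst) hn) (PrimrecPred.not ?_)
  exact Primrec.eq.comp (list_take.comp hn fst) (list_take.comp hn (snd.comp snd))

open Classical in
theorem computable₂_levelsDiffer (hcomp : Computable f) :
    Computable₂ fun (q : ℕ × ℕ) (t : ℕ) =>
      decide (LevelsDiffer (stage f (q.2 + t)) (q.1 + 1, stage f q.2)) := by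
  have hstage := computable_stage hcomp
  have h1 : Computable fun p : (ℕ × ℕ) × ℕ => stage f (p.1.2 + p.2) :=
    hstage.comp (Primrec.nat_add.comp (Primrec.snd.comp Primrec.fst) Primrec.snd).to_comp
  have h2 : Computable fun p : (ℕ × ℕ) × ℕ => stage f p.1.2 :=
    hstage.comp (Computable.snd.comp Computable.fst)
  have h3 : Computable fun p : (ℕ × ℕ) × ℕ => p.1.1 + 1 :=
    Computable.succ.comp (Computable.fst.comp Computable.fst)
  exact primrecRel_levelsDiffer.decide.to_comp.comp h1 (h3.pair h2)

theorem computable₂_headI_length (hcomp : Computable f) :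
    Computable₂ fun e s : ℕ => ((stage f s).strings e).headI.length + 1 := by
  have h : Primrec₂ fun (S : TreeStage) (e : ℕ) => (S.strings e).headI.length + 1 :=
    Primrec.succ.comp (Primrec.list_length.comp (Primrec.list_headI.comp primrec₂_strings))
  exact h.to_comp.comp ((computable_stage hcomp).comp Computable.snd) Computable.fst

/-- Instability of a stage is witnessed by one later stage, so it is r.e. and 0' can search for a
stable stage, from which the length of the limit strings is read off. -/
theorem IsLimit.exists_turingReducible {B : ℕ → List (List Bool)} {C : ℕ → List (ℕ × List ℕ)}
    (hf : Sound f) (hcomp : Computable f) (hB : IsLimit f B C) :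
    ∃ m : ℕ → ℕ, TuringReducible (m : ℕ →. ℕ) (zeroJump : ℕ →. ℕ) ∧
      ∀ e, m e = levelLength B e + 1 := by
  classical
  let D : ℕ × ℕ → ℕ → Bool := fun q t =>
    decide (LevelsDiffer (stage f (q.2 + t)) (q.1 + 1, stage f q.2))
  have hstable (e s : ℕ) : ¬ (∃ t, D (e, s) t = true) ↔ IsStable f (e + 1) s := by
    simp only [D, decide_eq_true_eq, not_exists]
    simp only [LevelsDiffer, not_or, not_not, not_lt]
    constructor
    · intro h t ht
      obtain ⟨d, rfl⟩ := Nat.exists_eq_add_of_le ht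
      exact h d
    · exact fun h t => h _ (Nat.le_add_right _ _)
  obtain ⟨m, hm, hmF⟩ := exists_turingReducible_zeroJump (p := fun e s => ∃ t, D (e, s) t = true)
    (computable₂_levelsDiffer hcomp).rePred_exists
    (fun e => by simpa only [hstable] using exists_isStable hf (e + 1))
    (computable₂_headI_length hcomp)
  refine ⟨m, hm, fun e => ?_⟩
  obtain ⟨s, hs, hms⟩ := hmF e
  rw [hms, (hB e s ((hstable e s).1 hs)).1, levelLength]

end TreeStage

theorem List.forall₂_ofFn {α β : Type*} {R : α → β → Prop} {n : ℕ} {X : Fin n → α} {Y : Fin n → β}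
    (h : ∀ t, R (X t) (Y t)) : List.Forall₂ R (List.ofFn X) (List.ofFn Y) := by
  refine List.forall₂_iff_get.2 ⟨by simp, fun a _ _ => ?_⟩
  simp only [List.get_ofFn]
  exact h _

theorem disjoint_or_subset_of_subsingleton {α : Type*} {S T : Set α} (hS : S.Subsingleton) :
    Disjoint S T ∨ S ⊆ T := by
  by_cases h : Disjoint S T
  · exact Or.inl h
  · obtain ⟨x, hx, hxT⟩ := Set.not_disjoint_iff.1 h
    exact Or.inr fun y hy => hS hx hy ▸ hxT

theorem mainTheorem11 :
    ∃ Q : Set (ℕ → Bool),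
      Q.Nonempty ∧ Perfect Q ∧ IsPiClass (toBaire '' Q) ∧
      ∃ m : ℕ → ℕ, TuringReducible (m : ℕ →. ℕ) (zeroJump : ℕ →. ℕ) ∧
        ∀ (e n : ℕ) (τ : Fin n → List Bool) (k : ℕ),
          m e ≤ k → (∀ i, (τ i).length = k) → Function.Injective τ →
            Disjoint (toBaire '' classProdN n fun i => Q ∩ stringNhd (τ i)) (piClass e) ∨
            (toBaire '' classProdN n fun i => Q ∩ stringNhd (τ i)) ⊆ piClass e := by
  obtain ⟨f, hcomp, hf, hcomplete⟩ := rePred_haltsOn_candidate.exists_enumeration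
  obtain ⟨B, C, hB⟩ := TreeStage.exists_isLimit hf
  have hT := hB.isTreeSequence hf
  obtain ⟨m, hm, hmB⟩ := hB.exists_turingReducible hf hcomp
  refine ⟨pathsOf B, hT.nonempty_pathsOf, hT.perfect_pathsOf, ?_, m, hm, ?_⟩
  · rw [hB.pathsOf_eq hf]
    exact TreeStage.isPiClass_toBaire_image hf hcomp
  intro e n τ k hk hτ hinj
  cases n with
  | zero => exact disjoint_or_subset_of_subsingleton (Set.subsingleton_singleton.image _)
  | succ n =>
    by_cases hne : ∀ t, (pathsOf B ∩ stringNhd (τ t)).Nonempty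
    -- The added 1 in `m e` makes k strictly larger than the string length at level e. The question
    -- is then decided at level j+1.
    · obtain ⟨j, hej, h1, h2⟩ := hT.exists_level (e := e) (k := k) (by rw [hmB] at hk; omega)
      choose i hi hiτ hiQ using fun t => hT.exists_entry h1 h2 (hτ t) (hne t)
      have hinj' : Function.Injective i := fun t t' h => hinj (by rw [hiτ t, hiτ t', h])
      simp only [hiQ]
      -- The two alternatives of the theorem correspond to whether the pair is settled in the limit.
      by_cases hmem : (e, List.ofFn i) ∈ C (j + 1)
      · left
        rw [Set.disjoint_left]
        rintro _ ⟨Z, hZ, rfl⟩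
        obtain ⟨X, hX, rfl⟩ := (mem_classProdN_succ n _ Z).1 hZ
        refine hB.forced hf hmem (List.ofFn X) ?_
        rw [selectEntries, List.map_ofFn]
        exact List.forall₂_ofFn fun t => (hX t).2
      · right
        rintro _ ⟨Z, hZ, rfl⟩
        obtain ⟨X, hX, rfl⟩ := (mem_classProdN_succ n _ Z).1 hZ
        exact hB.mem_piClass_of_notMem hf hcomplete (by omega) (Nat.succ_ne_zero n) hinj'
          (fun t => by rw [← hT.length_eq]; exact hi t) hmem hX
    -- A factor without paths makes the product empty.
    · left
      push Not at hne
      obtain ⟨t, ht⟩ := hne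
      rw [Set.disjoint_left]
      rintro _ ⟨Z, hZ, rfl⟩
      obtain ⟨X, hX, rfl⟩ := (mem_classProdN_succ n _ Z).1 hZ
      have := hX t
      rw [ht] at this
      exact absurd this (Set.notMem_empty _)
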